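/- Let $C$ be a set of constants. A \emph{$\bot$-free Böhm tree} over $C$ is a possibly infinite $\lambda$-tree $M=\lambda x_1\dots\lambda x_l.\,h\cdot(M_1;\dots;M_m)$ (up to $\alpha$-equivalence) with finitely many abstractions, a head $h$ that is a variable or a constant $c\in C$, and finitely many arguments $M_i$, which are again such trees. A \emph{trace} of $M$ is the sequence of heads along a branch from the root, and $M$ is \emph{productive} if each of its infinite traces contains infinitely many occurrences of constants. Let $\Sigma_6$ be the CoLF$^\omega$ signature that declares, in this order, the type families $\mathtt{ctm}:\mathsf{type}$, $\mathtt{ntm}:\mathsf{type}$, $\mathtt{t\_spine}:\mathsf{type}$, $\mathtt{s\_spine}:\mathsf{type}$, $\mathtt{p\_ctm}:\mathsf{cotype}$, $\mathtt{vars}:\mathsf{type}$, $\mathtt{consts}:\mathsf{type}$, and the constants $\mathtt{lam}:(\mathtt{vars}\to\mathtt{ctm})\to\mathtt{ctm}$, $\mathtt{base}:\mathtt{ntm}\to\mathtt{ctm}$, $\mathtt{varntm}:\mathtt{vars}\to\mathtt{t\_spine}\to\mathtt{ntm}$, $\mathtt{constntm}:\mathtt{consts}\to\mathtt{s\_spine}\to\mathtt{ntm}$,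 $\mathtt{tnil}:\mathtt{t\_spine}$, $\mathtt{tcons}:\mathtt{ctm}\to\mathtt{t\_spine}\to\mathtt{t\_spine}$, $\mathtt{snil}:\mathtt{s\_spine}$, $\mathtt{scons}:\mathtt{p\_ctm}\to\mathtt{s\_spine}\to\mathtt{s\_spine}$, $\mathtt{progress}:\mathtt{ctm}\to\mathtt{p\_ctm}$, and $c:\mathtt{consts}$ for every $c\in C$. Thus $\mathtt{progress}$ is the only coinductive constructor, i.e. the only constructor of a family of kind $\mathsf{cotype}$. The \emph{terms} of CoLF$^\omega$ are the $\bot$-free Böhm trees over the constants of the signature that have an observation at each finite depth $k$, where an observation of depth $k$ is a finite term: nothing is observed at depth $0$; an observation of depth $k+1$ shows the abstractions and the head, and the arguments are observed at depth $k+1$ if the head is a variable and at depth $k$ if it is a constant. An \emph{infinitary canonical term} of type $A$ in a context $\Gamma$ is a term $M$ such that for every $k$ the observation of $M$ at depth $k$ checks against $A$ in $\Gamma$ by the ($\beta$-normal, $\eta$-long) typing rules of LF, read up to depth $k$, and such that $M$ is \emph{valid}: along each infinite trace of $M$, some coinductive constructor occurs infinitely often, and no constructor that occurs infinitely often has a higher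 priority, where a constructor has the priority of its type family, and families declared later have higher priority. The encoding $\ulcorner\cdot\urcorner$ of $\bot$-free Böhm trees over $C$ is given by $\ulcorner\lambda x_1\dots\lambda x_l.\,R\urcorner=\mathtt{lam}\,([x_1]\dots\mathtt{lam}\,([x_l]\,\mathtt{base}\,\ulcorner R\urcorner))$ for neutral $R$, where \[\ulcorner x\cdot(M_1;\dots;M_m)\urcorner=\mathtt{varntm}\;x\;(\mathtt{tcons}\,\ulcorner M_1\urcorner\,(\dots(\mathtt{tcons}\,\ulcorner M_m\urcorner\,\mathtt{tnil}))),\] \[\ulcorner c\cdot(M_1;\dots;M_m)\urcorner=\mathtt{constntm}\;c\;(\mathtt{scons}\,(\mathtt{progress}\,\ulcorner M_1\urcorner)\,(\dots(\mathtt{scons}\,(\mathtt{progress}\,\ulcorner M_m\urcorner)\,\mathtt{snil}))).\] \textbf{Theorem (Adequacy of Encoding).} There is a map $\ulcorner\cdot\urcorner$ satisfying these equations, and for every $n\ge 0$ it restricts to a bijection between the productive $\bot$-free Böhm trees over $C$ with free variables among $x_1,\dots,x_n$ and the infinitary canonical terms of type $\mathtt{ctm}$ in the context $x_1:\mathtt{vars},\dots,x_n:\mathtt{vars}$.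 In particular ($n=0$), there is a bijection between the closed productive $\bot$-free Böhm trees and the infinitary canonical terms of type $\mathtt{ctm}$. -/

import Mathlib

universe u v

/-! ## Infinite `⊥`-free Böhm trees with constants

Variables are de Bruijn indices.  A tree is `λ x₁ … λ x_l. h · (M₁; …; M_m)`, with finitely many
abstractions, a head `h`, and finitely many arguments, which are again trees, without end. -/

/-- The head of a neutral term: a variable or a constant. -/
inductive Head (C : Type u) : Type u
  | var (i : ℕ) : Head C
  | con (c : C) : Head C

/-- The shape of a node: number of abstractions, head, number of arguments. -/
def bohmFunctor (C : Type u) : PFunctor.{u, 0} where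
  A := ℕ × Head C × ℕ
  B := fun a => Fin a.2.2

/-- `⊥`-free Böhm trees over the constants `C`: the final coalgebra of `bohmFunctor C`. -/
def BohmTree (C : Type u) : Type u := (bohmFunctor C).M

namespace BohmTree

variable {C : Type u}

/-- `λ x₁ … λ x_l. h · (M₁; …; M_m)`. -/
def node (l : ℕ) (h : Head C) (Ms : List (BohmTree C)) : BohmTree C :=
  PFunctor.M.mk (F := bohmFunctor C) ⟨(l, h, Ms.length), fun i => Ms.get i⟩

/-- The number of leading abstractions. -/
def lams (M : BohmTree C) : ℕ := (PFunctor.M.dest (F := bohmFunctor C) M).1.1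

/-- The head. -/
def head (M : BohmTree C) : Head C := (PFunctor.M.dest (F := bohmFunctor C) M).1.2.1

/-- The arguments of the head. -/
def args (M : BohmTree C) : List (BohmTree C) :=
  List.ofFn (n := (PFunctor.M.dest (F := bohmFunctor C) M).1.2.2)
    (PFunctor.M.dest (F := bohmFunctor C) M).2

/-- `T` is an infinite trace of `M`: the sequence of heads along an infinite branch. -/
def IsInfTrace (M : BohmTree C) (T : ℕ → Head C) : Prop :=
  ∃ b : ℕ → BohmTree C, b 0 = M ∧ (∀ i, b (i + 1) ∈ (b i).args) ∧ ∀ i, T i = (b i).head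

/-- Infinitely many occurrences of constants along each infinite trace. -/
def Productive (M : BohmTree C) : Prop :=
  ∀ T, IsInfTrace M T → ∀ N, ∃ i, N ≤ i ∧ ∃ c, T i = Head.con c

/-- `Occurs n M m L`: if `M` is read in the scope of `n` variables, then `L` occurs in `M` in the
scope of `m` variables. -/
inductive Occurs (n : ℕ) (M : BohmTree C) : ℕ → BohmTree C → Prop
  | root : Occurs n M n M
  | arg {m : ℕ} {L L' : BohmTree C} : Occurs n M m L → L' ∈ L.args → Occurs n M (m + L.lams) L'

/-- All free variables of `M` are among the `n` variables with indices `0, …, n - 1`. -/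
def ScopedIn (n : ℕ) (M : BohmTree C) : Prop :=
  ∀ m L, Occurs n M m L → ∀ i, L.head = Head.var i → i < m + L.lams

end BohmTree

/-! ## Syntax of the framework at a finite observation depth

`Can K k`, `Neu K k`, `TSp K k`, `SSp K k` are the canonical terms, neutral terms, continuing spines
and suspended spines of observation depth `k` over the constants `K`. -/

mutual
/-- Canonical terms of observation depth `k`. -/
inductive Can (K : Type u) : ℕ → Type u
  | unobs : Can K 0
  | lam {k : ℕ} (M : Can K (k + 1)) : Can K (k + 1)
  | neu {k : ℕ} (R : Neu K (k + 1)) : Can K (k + 1)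
/-- Neutral terms of observation depth `k`. -/
inductive Neu (K : Type u) : ℕ → Type u
  | unobs : Neu K 0
  | var {k : ℕ} (i : ℕ) (T : TSp K (k + 1)) : Neu K (k + 1)
  | con {k : ℕ} (c : K) (S : SSp K (k + 1)) : Neu K (k + 1)
/-- Continuing spines: the arguments are observed in the same observation. -/
inductive TSp (K : Type u) : ℕ → Type u
  | unobs : TSp K 0
  | nil {k : ℕ} : TSp K (k + 1)
  | cons {k : ℕ} (M : Can K (k + 1)) (T : TSp K (k + 1)) : TSp K (k + 1)
/-- Suspended spines: the arguments are observed in the next observation. -/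
inductive SSp (K : Type u) : ℕ → Type u
  | unobs : SSp K 0
  | nil {k : ℕ} : SSp K (k + 1)
  | cons {k : ℕ} (M : Can K k) (S : SSp K (k + 1)) : SSp K (k + 1)
end

/-- Canonical types of observation depth `k` over the type families `F` and the constants `K`;
the atomic types are those of the form `a · S`. -/
inductive Ty (F : Type v) (K : Type u) : ℕ → Type (max u v)
  | unobs : Ty F K 0
  | atom {k : ℕ} (a : F) (S : SSp K (k + 1)) : Ty F K (k + 1)
  | pi {k : ℕ} (B A : Ty F K (k + 1)) : Ty F K (k + 1)

section Operations

variable {F : Type v} {K : Type u}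

mutual
/-- Weakening: increment the variables with index at least `d`. -/
def Can.shift (d : ℕ) : {k : ℕ} → Can K k → Can K k
  | _, .unobs => .unobs
  | _, .lam M => .lam (Can.shift (d + 1) M)
  | _, .neu R => .neu (Neu.shift d R)
/-- Weakening of neutral terms. -/
def Neu.shift (d : ℕ) : {k : ℕ} → Neu K k → Neu K k
  | _, .unobs => .unobs
  | _, .var i T => .var (if i < d then i else i + 1) (TSp.shift d T)
  | _, .con c S => .con c (SSp.shift d S)
/-- Weakening of continuing spines. -/
def TSp.shift (d : ℕ) : {k : ℕ} → TSp K k → TSp K k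
  | _, .unobs => .unobs
  | _, .nil => .nil
  | _, .cons M T => .cons (Can.shift d M) (TSp.shift d T)
/-- Weakening of suspended spines. -/
def SSp.shift (d : ℕ) : {k : ℕ} → SSp K k → SSp K k
  | _, .unobs => .unobs
  | _, .nil => .nil
  | _, .cons M S => .cons (Can.shift d M) (SSp.shift d S)
end

/-- Weakening of types. -/
def Ty.shift (d : ℕ) : {k : ℕ} → Ty F K k → Ty F K k
  | _, .unobs => .unobs
  | _, .atom a S => .atom a (S.shift d)
  | _, .pi B A => .pi (Ty.shift d B) (Ty.shift (d + 1) A)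

mutual
/-- A term viewed at observation depth one less. -/
def Can.trunc : {k : ℕ} → Can K k → Can K (k - 1)
  | _, .unobs => .unobs
  | 1, .lam _ => .unobs
  | _ + 2, .lam M => .lam (Can.trunc M)
  | 1, .neu _ => .unobs
  | _ + 2, .neu R => .neu (Neu.trunc R)
/-- A neutral term viewed at observation depth one less. -/
def Neu.trunc : {k : ℕ} → Neu K k → Neu K (k - 1)
  | _, .unobs => .unobs
  | 1, .var _ _ => .unobs
  | _ + 2, .var i T => .var i (TSp.trunc T)
  | 1, .con _ _ => .unobs
  | _ + 2, .con c S => .con c (SSp.trunc S)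
/-- A continuing spine viewed at observation depth one less. -/
def TSp.trunc : {k : ℕ} → TSp K k → TSp K (k - 1)
  | _, .unobs => .unobs
  | 1, .nil => .unobs
  | _ + 2, .nil => .nil
  | 1, .cons _ _ => .unobs
  | _ + 2, .cons M T => .cons (Can.trunc M) (TSp.trunc T)
/-- A suspended spine viewed at observation depth one less. -/
def SSp.trunc : {k : ℕ} → SSp K k → SSp K (k - 1)
  | _, .unobs => .unobs
  | 1, .nil => .unobs
  | _ + 2, .nil => .nil
  | 1, .cons _ _ => .unobs
  | _ + 2, .cons M S => .cons (Can.trunc M) (SSp.trunc S)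
end

/-- A type viewed at observation depth one less. -/
def Ty.trunc : {k : ℕ} → Ty F K k → Ty F K (k - 1)
  | _, .unobs => .unobs
  | 1, .atom _ _ => .unobs
  | _ + 2, .atom a S => .atom a S.trunc
  | 1, .pi _ _ => .unobs
  | _ + 2, .pi B A => .pi (Ty.trunc B) (Ty.trunc A)

/-- Simple types. -/
inductive SimpleTy : Type
  | base : SimpleTy
  | arr (τ₂ τ₁ : SimpleTy) : SimpleTy

/-- Erasure of an observable type to a simple type (the value at depth `0` is irrelevant). -/
def Ty.erase : {k : ℕ} → Ty F K k → SimpleTy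
  | _, .unobs => .base
  | _, .atom _ _ => .base
  | _, .pi B A => .arr (Ty.erase B) (Ty.erase A)

/-- The type family `a` at the end of `Π x₁ … Π x_n : A_n. a · S` (undefined at depth `0`). -/
def Ty.target : {k : ℕ} → Ty F K k → Option F
  | _, .unobs => none
  | _, .atom a _ => some a
  | _, .pi _ A => Ty.target A

end Operations

/-! ## Hereditary substitution

`HSubCan N j τ M M'` is the judgment `[N/x]^τ M = M'` at the depth of `M`, where `x` is the
variable with index `j`, and `N` is already weakened to the context of `M` without `x`. -/

mutual
/-- Hereditary substitution in canonical terms. -/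
inductive HSubCan {K : Type u} :
    {k : ℕ} → Can K k → ℕ → SimpleTy → Can K k → Can K k → Prop
  | unobs {N : Can K 0} {j : ℕ} {τ : SimpleTy} {M M' : Can K 0} : HSubCan N j τ M M'
  | neu {k : ℕ} {N : Can K (k + 1)} {j : ℕ} {τ : SimpleTy} {R R' : Neu K (k + 1)} :
      HSubNeu N j τ R R' → HSubCan N j τ (.neu R) (.neu R')
  | lam {k : ℕ} {N : Can K (k + 1)} {j : ℕ} {τ : SimpleTy} {M M' : Can K (k + 1)} :
      HSubCan (N.shift 0) (j + 1) τ M M' → HSubCan N j τ (.lam M) (.lam M')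
/-- Hereditary substitution in neutral terms. -/
inductive HSubNeu {K : Type u} :
    {k : ℕ} → Can K k → ℕ → SimpleTy → Neu K k → Neu K k → Prop
  | unobs {N : Can K 0} {j : ℕ} {τ : SimpleTy} {R R' : Neu K 0} : HSubNeu N j τ R R'
  | hit {k : ℕ} {N : Can K (k + 1)} {j : ℕ} {τ : SimpleTy} {T T' : TSp K (k + 1)}
      {R : Neu K (k + 1)} :
      HSubTSp N j τ T T' → SpineApp T' τ N R → HSubNeu N j τ (.var j T) R
  | lt {k : ℕ} {N : Can K (k + 1)} {j : ℕ} {τ : SimpleTy} {i : ℕ} {T T' : TSp K (k + 1)} :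
      i < j → HSubTSp N j τ T T' → HSubNeu N j τ (.var i T) (.var i T')
  | gt {k : ℕ} {N : Can K (k + 1)} {j : ℕ} {τ : SimpleTy} {i : ℕ} {T T' : TSp K (k + 1)} :
      j ≤ i → HSubTSp N j τ T T' → HSubNeu N j τ (.var (i + 1) T) (.var i T')
  | con {k : ℕ} {N : Can K (k + 1)} {j : ℕ} {τ : SimpleTy} {c : K} {S S' : SSp K (k + 1)} :
      HSubSSp (k := k) N.trunc j τ S S' → HSubNeu N j τ (.con c S) (.con c S')
/-- Hereditary substitution in continuing spines. -/
inductive HSubTSp {K : Type u} :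
    {k : ℕ} → Can K k → ℕ → SimpleTy → TSp K k → TSp K k → Prop
  | unobs {N : Can K 0} {j : ℕ} {τ : SimpleTy} {T T' : TSp K 0} : HSubTSp N j τ T T'
  | nil {k : ℕ} {N : Can K (k + 1)} {j : ℕ} {τ : SimpleTy} : HSubTSp N j τ .nil .nil
  | cons {k : ℕ} {N : Can K (k + 1)} {j : ℕ} {τ : SimpleTy} {M M' : Can K (k + 1)}
      {T T' : TSp K (k + 1)} :
      HSubCan N j τ M M' → HSubTSp N j τ T T' → HSubTSp N j τ (.cons M T) (.cons M' T')
/-- Application of a continuing spine to a canonical term, `T ▷^τ N = R`. -/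
inductive SpineApp {K : Type u} :
    {k : ℕ} → TSp K k → SimpleTy → Can K k → Neu K k → Prop
  | unobs {T : TSp K 0} {τ : SimpleTy} {N : Can K 0} {R : Neu K 0} : SpineApp T τ N R
  | nil {k : ℕ} {R : Neu K (k + 1)} : SpineApp .nil .base (.neu R) R
  | cons {k : ℕ} {N : Can K (k + 1)} {T : TSp K (k + 1)} {τ₂ τ₁ : SimpleTy}
      {M M' : Can K (k + 1)} {R : Neu K (k + 1)} :
      HSubCan N 0 τ₂ M M' → SpineApp T τ₁ M' R → SpineApp (.cons N T) (.arr τ₂ τ₁) (.lam M) R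
/-- Hereditary substitution of a term of depth `k` in suspended spines of depth `k + 1`. -/
inductive HSubSSp {K : Type u} :
    {k : ℕ} → Can K k → ℕ → SimpleTy → SSp K (k + 1) → SSp K (k + 1) → Prop
  | nil {k : ℕ} {N : Can K k} {j : ℕ} {τ : SimpleTy} : HSubSSp N j τ .nil .nil
  | cons {k : ℕ} {N : Can K k} {j : ℕ} {τ : SimpleTy} {M M' : Can K k}
      {S S' : SSp K (k + 1)} :
      HSubCan N j τ M M' → HSubSSp N j τ S S' → HSubSSp N j τ (.cons M S) (.cons M' S')
end

/-- Hereditary substitution of a term of depth `k` in types of depth `k + 1`. -/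
inductive HSubTy {F : Type v} {K : Type u} :
    {k : ℕ} → Can K k → ℕ → SimpleTy → Ty F K (k + 1) → Ty F K (k + 1) → Prop
  | atom {k : ℕ} {N : Can K k} {j : ℕ} {τ : SimpleTy} {a : F} {S S' : SSp K (k + 1)} :
      HSubSSp N j τ S S' → HSubTy N j τ (.atom a S) (.atom a S')
  | pi {k : ℕ} {N : Can K k} {j : ℕ} {τ : SimpleTy} {B B' A A' : Ty F K (k + 1)} :
      HSubTy N j τ B B' → HSubTy (N.shift 0) (j + 1) τ A A' →
      HSubTy N j τ (.pi B A) (.pi B' A')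

/-! ## Signatures and typing -/

/-- A type of depth `ω`: a coherent sequence of observations. -/
structure TyOmega (F : Type v) (K : Type u) : Type (max u v) where
  /-- The observation at depth `k`. -/
  obs : (k : ℕ) → Ty F K k
  coherent : ∀ k, (obs (k + 1)).trunc = obs k

/-- Kinds of depth `ω` (their own structure is finitary). -/
inductive Knd (F : Type v) (K : Type u) : Type (max u v)
  | type : Knd F K
  | cotype : Knd F K
  | pi (A : TyOmega F K) (L : Knd F K) : Knd F K

/-- The kind has the form `Π y₁ … Π y_m : B_m. cotype`. -/
def Knd.IsCotype {F : Type v} {K : Type u} : Knd F K → Prop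
  | .type => False
  | .cotype => True
  | .pi _ L => L.IsCotype

/-- A signature of depth `ω`: a kind for every type family, a type for every constant, and the
place of each type family in the order of declaration. -/
structure Signature (F : Type v) (K : Type u) : Type (max u v) where
  /-- The declared kind of a type family. -/
  kind : F → Knd F K
  /-- The declared type of a constant. -/
  ty : K → TyOmega F K
  /-- The place of the declaration of a type family; later means higher priority. -/
  rank : F → ℕ

/-- `x : A ∈ Γ`, for `x` the variable with index `i`; the innermost variable comes first. -/
inductive Lookup {F : Type v} {K : Type u} {k : ℕ} : List (Ty F K k) → ℕ → Ty F K k → Prop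
  | zero {Γ : List (Ty F K k)} {A : Ty F K k} : Lookup (A :: Γ) 0 (A.shift 0)
  | succ {Γ : List (Ty F K k)} {A B : Ty F K k} {i : ℕ} :
      Lookup Γ i A → Lookup (B :: Γ) (i + 1) (A.shift 0)

mutual
/-- `Γ ⊢ M ⇐ A` at depth `k`. -/
inductive CheckCan {F : Type v} {K : Type u} (Sg : Signature F K) :
    {k : ℕ} → List (Ty F K k) → Can K k → Ty F K k → Prop
  | unobs {Γ : List (Ty F K 0)} {M : Can K 0} {A : Ty F K 0} : CheckCan Sg Γ M A
  | neu {k : ℕ} {Γ : List (Ty F K (k + 1))} {R : Neu K (k + 1)} {a : F} {S : SSp K (k + 1)} :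
      SynNeu Sg Γ R (.atom a S) → CheckCan Sg Γ (.neu R) (.atom a S)
  | lam {k : ℕ} {Γ : List (Ty F K (k + 1))} {M : Can K (k + 1)} {B A : Ty F K (k + 1)} :
      CheckCan Sg (B :: Γ) M A → CheckCan Sg Γ (.lam M) (.pi B A)
/-- `Γ ⊢ R ⇒ P` at depth `k`. -/
inductive SynNeu {F : Type v} {K : Type u} (Sg : Signature F K) :
    {k : ℕ} → List (Ty F K k) → Neu K k → Ty F K k → Prop
  | unobs {Γ : List (Ty F K 0)} {R : Neu K 0} {P : Ty F K 0} : SynNeu Sg Γ R P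
  | var {k : ℕ} {Γ : List (Ty F K (k + 1))} {i : ℕ} {T : TSp K (k + 1)}
      {A P : Ty F K (k + 1)} :
      Lookup Γ i A → SynTSp Sg Γ T A P → SynNeu Sg Γ (.var i T) P
  | con {k : ℕ} {Γ : List (Ty F K (k + 1))} {c : K} {S : SSp K (k + 1)} {P : Ty F K (k + 1)} :
      SynSSp Sg Γ S ((Sg.ty c).obs (k + 1)) P → SynNeu Sg Γ (.con c S) P
/-- `Γ ⊢ T ▷ A ⇒ P` at depth `k`, for continuing spines. -/
inductive SynTSp {F : Type v} {K : Type u} (Sg : Signature F K) :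
    {k : ℕ} → List (Ty F K k) → TSp K k → Ty F K k → Ty F K k → Prop
  | unobs {Γ : List (Ty F K 0)} {T : TSp K 0} {A P : Ty F K 0} : SynTSp Sg Γ T A P
  | nil {k : ℕ} {Γ : List (Ty F K (k + 1))} {a : F} {S : SSp K (k + 1)} :
      SynTSp Sg Γ .nil (.atom a S) (.atom a S)
  | cons {k : ℕ} {Γ : List (Ty F K (k + 1))} {M : Can K (k + 1)} {T : TSp K (k + 1)}
      {B A A' P : Ty F K (k + 1)} :
      CheckCan Sg Γ M B → HSubTy (k := k) M.trunc 0 B.erase A A' → SynTSp Sg Γ T A' P →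
      SynTSp Sg Γ (.cons M T) (.pi B A) P
/-- `Γ ⊢ S ▷ A ⇒ P` at depth `k`, for suspended spines; the arguments, observable only at the next
smaller depth, are checked at that depth. -/
inductive SynSSp {F : Type v} {K : Type u} (Sg : Signature F K) :
    {k : ℕ} → List (Ty F K k) → SSp K k → Ty F K k → Ty F K k → Prop
  | unobs {Γ : List (Ty F K 0)} {S : SSp K 0} {A P : Ty F K 0} : SynSSp Sg Γ S A P
  | nil {k : ℕ} {Γ : List (Ty F K (k + 1))} {a : F} {S : SSp K (k + 1)} :
      SynSSp Sg Γ .nil (.atom a S) (.atom a S)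
  | cons {k : ℕ} {Γ : List (Ty F K (k + 1))} {M : Can K k} {S : SSp K (k + 1)}
      {B A A' P : Ty F K (k + 1)} :
      CheckCan Sg (k := k) (Γ.map Ty.trunc) M B.trunc → HSubTy M 0 B.erase A A' →
      SynSSp Sg Γ S A' P → SynSSp Sg Γ (.cons M S) (.pi B A) P
end

/-! ## Infinitary canonical terms -/

/-- `λ x₁ … λ x_l. M` at a positive depth. -/
def Can.lamN {K : Type u} {k : ℕ} : ℕ → Can K (k + 1) → Can K (k + 1)
  | 0, M => M
  | l + 1, M => .lam (Can.lamN l M)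

mutual
/-- `Observe k M m`: the observation of the infinite tree `M` at depth `k` is `m`. It exists at
every depth exactly if `M` is generated by the grammar of canonical terms. -/
inductive Observe {K : Type u} : (k : ℕ) → BohmTree K → Can K k → Prop
  | zero (M : BohmTree K) : Observe 0 M .unobs
  | var {k : ℕ} {M : BohmTree K} {i : ℕ} {T : TSp K (k + 1)} :
      M.head = Head.var i → ObserveT k M.args T →
      Observe (k + 1) M (Can.lamN M.lams (.neu (.var i T)))
  | con {k : ℕ} {M : BohmTree K} {c : K} {S : SSp K (k + 1)} :
      M.head = Head.con c → ObserveS k M.args S →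
      Observe (k + 1) M (Can.lamN M.lams (.neu (.con c S)))
/-- Arguments of a variable, observed at depth `k + 1` together with the variable. -/
inductive ObserveT {K : Type u} : (k : ℕ) → List (BohmTree K) → TSp K (k + 1) → Prop
  | nil {k : ℕ} : ObserveT k [] .nil
  | cons {k : ℕ} {M : BohmTree K} {Ms : List (BohmTree K)} {m : Can K (k + 1)}
      {T : TSp K (k + 1)} :
      Observe (k + 1) M m → ObserveT k Ms T → ObserveT k (M :: Ms) (.cons m T)
/-- Arguments of a constant that is observed at depth `k + 1`. -/
inductive ObserveS {K : Type u} : (k : ℕ) → List (BohmTree K) → SSp K (k + 1) → Prop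
  | nil {k : ℕ} : ObserveS k [] .nil
  | cons {k : ℕ} {M : BohmTree K} {Ms : List (BohmTree K)} {m : Can K k} {S : SSp K (k + 1)} :
      Observe k M m → ObserveS k Ms S → ObserveS k (M :: Ms) (.cons m S)
end

namespace Signature

variable {F : Type v} {K : Type u}

/-- The type family that the constant `c` constructs is `a`. -/
def Constructs (Sg : Signature F K) (c : K) (a : F) : Prop :=
  ((Sg.ty c).obs 1).target = some a

/-- Coinductive constructors. -/
def Coinductive (Sg : Signature F K) (c : K) : Prop :=
  ∃ a, Sg.Constructs c a ∧ (Sg.kind a).IsCotype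

/-- The priority of `c` is at most that of `c'`; constructors inherit priorities from their
type families. -/
def PriorityLE (Sg : Signature F K) (c c' : K) : Prop :=
  ∃ a a', Sg.Constructs c a ∧ Sg.Constructs c' a' ∧ Sg.rank a ≤ Sg.rank a'

/-- Validity: along each infinite trace, a constructor of highest priority among those that occur
infinitely often exists and is coinductive. -/
def TraceValid (Sg : Signature F K) (M : BohmTree K) : Prop :=
  ∀ T, M.IsInfTrace T → ∃ c, Sg.Coinductive c ∧ (∀ N, ∃ i, N ≤ i ∧ T i = Head.con c) ∧
    ∀ c', (∀ N, ∃ i, N ≤ i ∧ T i = Head.con c') → Sg.PriorityLE c' c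

/-- `M` is an infinitary canonical term of type `A` in the context `Γ`: at every depth `k` its
observation exists and has the type `A` observed at depth `k`, and `M` is valid. -/
def IsCanonicalTerm (Sg : Signature F K) (Γ : List (TyOmega F K)) (M : BohmTree K)
    (A : TyOmega F K) : Prop :=
  (∀ k, ∃ m : Can K k, Observe k M m ∧ CheckCan Sg (Γ.map fun B => B.obs k) m (A.obs k)) ∧
    Sg.TraceValid M

end Signature

/-! ## The signature -/

/-- Finitary types built from type families without arguments by `→`. -/
inductive ArrowTy (F : Type v) : Type v
  | fam (a : F) : ArrowTy F
  | arr (B A : ArrowTy F) : ArrowTy F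

/-- Expansion of a finitary type to depth `k`. No variable occurs in such types, so that `B → A`
becomes `Π x : B. A` without any weakening. -/
def ArrowTy.expand {F : Type v} (K : Type u) : (k : ℕ) → ArrowTy F → Ty F K k
  | 0, _ => .unobs
  | _ + 1, .fam a => .atom a .nil
  | k + 1, .arr B A => .pi (ArrowTy.expand K (k + 1) B) (ArrowTy.expand K (k + 1) A)

theorem ArrowTy.trunc_expand {F : Type v} (K : Type u) (k : ℕ) (A : ArrowTy F) :
    (A.expand K (k + 1)).trunc = A.expand K k := by
  induction A with
  | fam a => cases k <;> simp [ArrowTy.expand, Ty.trunc, SSp.trunc]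
  | arr B A ihB ihA =>
    cases k with
    | zero => simp [ArrowTy.expand, Ty.trunc]
    | succ k => simpa [ArrowTy.expand, Ty.trunc] using ⟨ihB, ihA⟩

/-- Expansion of a finitary type to depth `ω`. -/
def ArrowTy.toOmega {F : Type v} (K : Type u) (A : ArrowTy F) : TyOmega F K where
  obs := fun k => A.expand K k
  coherent := fun k => A.trunc_expand K k

namespace Internal

/-- The type families, in the order of their declaration. -/
inductive Fam : Type
  | ctm | ntm | tSpine | sSpine | pCtm | vars | consts

/-- The constants; `const c` is the declaration `c : consts` for a constant `c` of the encoded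
language. -/
inductive Con (C : Type u) : Type u
  | lam | base | varntm | constntm | tnil | tcons | snil | scons | progress
  | const (c : C)

/-- Place in the order of declaration. -/
def famRank : Fam → ℕ
  | .ctm => 0
  | .ntm => 1
  | .tSpine => 2
  | .sSpine => 3
  | .pCtm => 4
  | .vars => 5
  | .consts => 6

/-- The declared kinds. -/
def famKind {K : Type u} : Fam → Knd Fam K
  | .ctm => .type
  | .ntm => .type
  | .tSpine => .type
  | .sSpine => .type
  | .pCtm => .cotype
  | .vars => .type
  | .consts => .type

/-- The declared types. -/
def conTy {C : Type u} : Con C → ArrowTy Fam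
  | .lam => .arr (.arr (.fam .vars) (.fam .ctm)) (.fam .ctm)
  | .base => .arr (.fam .ntm) (.fam .ctm)
  | .varntm => .arr (.fam .vars) (.arr (.fam .tSpine) (.fam .ntm))
  | .constntm => .arr (.fam .consts) (.arr (.fam .sSpine) (.fam .ntm))
  | .tnil => .fam .tSpine
  | .tcons => .arr (.fam .ctm) (.arr (.fam .tSpine) (.fam .tSpine))
  | .snil => .fam .sSpine
  | .scons => .arr (.fam .pCtm) (.arr (.fam .sSpine) (.fam .sSpine))
  | .progress => .arr (.fam .ctm) (.fam .pCtm)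
  | .const _ => .fam .consts

/-- The signature, with a declaration `c : consts` for every `c : C`. -/
def sig (C : Type u) : Signature Fam (Con C) where
  kind := famKind
  ty := fun c => (conTy c).toOmega (Con C)
  rank := famRank

/-- The context `x₁ : vars, …, x_n : vars`. -/
def varsCtx (C : Type u) (n : ℕ) : List (TyOmega Fam (Con C)) :=
  List.replicate n ((ArrowTy.fam Fam.vars).toOmega (Con C))

/-- The type `ctm`. -/
def ctmTy (C : Type u) : TyOmega Fam (Con C) := (ArrowTy.fam Fam.ctm).toOmega (Con C)

/-! ### Compositional description of the encoding -/

variable {C : Type u}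

/-- `c · (M₁; …; M_m)`. -/
def app (c : Con C) (Ms : List (BohmTree (Con C))) : BohmTree (Con C) :=
  BohmTree.node 0 (Head.con c) Ms

/-- `[x] M`, one more abstraction in front of `M`. -/
def abs (M : BohmTree (Con C)) : BohmTree (Con C) :=
  BohmTree.node (M.lams + 1) M.head M.args

/-- `lam ([x₁] lam ([x₂] … lam ([x_l] M)))`. -/
def lamN : ℕ → BohmTree (Con C) → BohmTree (Con C)
  | 0, M => M
  | l + 1, M => app .lam [abs (lamN l M)]

/-- `tcons M₁ (tcons M₂ … tnil)`. -/
def tSpine : List (BohmTree (Con C)) → BohmTree (Con C)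
  | [] => app .tnil []
  | M :: Ms => app .tcons [M, tSpine Ms]

/-- `scons (progress M₁) (scons (progress M₂) … snil)`. -/
def sSpine : List (BohmTree (Con C)) → BohmTree (Con C)
  | [] => app .snil []
  | M :: Ms => app .scons [app .progress [M], sSpine Ms]

/-- `varntm x T` for a variable `x` and `constntm c S` for a constant `c`. -/
def neutral : Head C → List (BohmTree (Con C)) → BohmTree (Con C)
  | .var i, Ms => app .varntm [BohmTree.node 0 (Head.var i) [], tSpine Ms]
  | .con c, Ms => app .constntm [app (.const c) [], sSpine Ms]

/-- `enc` encodes trees compositionally: abstractions by `lam`, neutral terms by `base`, and heads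
with their arguments by `varntm` and `constntm`. -/
def IsEncoding (enc : BohmTree C → BohmTree (Con C)) : Prop :=
  ∀ (l : ℕ) (h : Head C) (Ms : List (BohmTree C)),
    enc (BohmTree.node l h Ms) = lamN l (app .base [neutral h (Ms.map enc)])

end Internal

-- The encoding of a node is a finite block of constructors, `encNode`, with the encoded arguments
-- hanging below it. The block determines the node (`encNode_inj`), so every compositional encoding
-- is injective by bisimulation. Every argument lies below at least one constant of its block, hence
-- is observed at a smaller depth; strong induction on the depth then types the encodings of
-- well-scoped trees (`IsEncoding.typedAt`).
--
-- Typing alone does not give surjectivity, since it admits infinite nests of `lam` and infinite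
-- spines. Such branches never meet `progress`, so validity excludes them. "Each infinite trace
-- meets `P`" is expressed as accessibility, `Reaches P`; induction on it shows that a typed valid
-- tree is an `encNode` over typed valid trees (`exists_eq_encNode`). Decoding is corecursive, and
-- `enc (decode N)` agrees with `N` up to every depth.
--
-- Productivity corresponds to validity because the block of a constant puts `progress` above each
-- argument and the block of a variable puts it above none. So `M` reaches a constant exactly if
-- `enc M` reaches `progress`, and this at all subtrees means infinite occurrence. Priorities are
-- harmless: of the families declared after `pCtm`, `vars` has no constructors, and those of
-- `consts` have no arguments and so lie on no infinite trace.

namespace BohmTree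

variable {K : Type u}

-- Nodes, corecursion and bisimulation

@[simp] theorem lams_node (l : ℕ) (h : Head K) (Ms : List (BohmTree K)) :
    (node l h Ms).lams = l := rfl

@[simp] theorem head_node (l : ℕ) (h : Head K) (Ms : List (BohmTree K)) :
    (node l h Ms).head = h := rfl

@[simp] theorem args_node (l : ℕ) (h : Head K) (Ms : List (BohmTree K)) :
    (node l h Ms).args = Ms := by
  change List.ofFn (fun i => Ms.get i) = Ms
  exact List.ofFn_get Ms

theorem mk_eq_node (l : ℕ) (h : Head K) (Ms : List (BohmTree K)) (n : ℕ)
    (f : Fin n → BohmTree K) (hf : List.ofFn f = Ms) :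
    (PFunctor.M.mk (F := bohmFunctor K) ⟨(l, h, n), f⟩ : BohmTree K) = node l h Ms := by
  obtain rfl : Ms.length = n := by rw [← hf, List.length_ofFn]
  obtain rfl : f = Ms.get := List.ofFn_injective (by rw [hf, List.ofFn_get])
  rfl

theorem node_eta (M : BohmTree K) : node M.lams M.head M.args = M := by
  rw [← mk_eq_node M.lams M.head M.args _ _ rfl]
  exact PFunctor.M.mk_dest (F := bohmFunctor K) M

theorem node_inj {l l' : ℕ} {h h' : Head K} {Ms Ms' : List (BohmTree K)} :
    node l h Ms = node l' h' Ms' ↔ l = l' ∧ h = h' ∧ Ms = Ms' := by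
  constructor
  · intro e
    exact ⟨by simpa using congrArg lams e, by simpa using congrArg head e,
      by simpa using congrArg args e⟩
  · rintro ⟨rfl, rfl, rfl⟩; rfl

/-- The tree generated from a state by repeated steps, each of which gives the abstractions, the
head, and the states that generate the arguments. -/
def unfold {S : Type v} (step : S → ℕ × Head K × List S) (s : S) : BohmTree K :=
  PFunctor.M.corec (F := bohmFunctor K)
    (fun s => ⟨((step s).1, (step s).2.1, (step s).2.2.length), fun i => (step s).2.2.get i⟩) s

theorem unfold_eq {S : Type v} (step : S → ℕ × Head K × List S) (s : S) :
    unfold step s = node (step s).1 (step s).2.1 ((step s).2.2.map (unfold step)) := by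
  rw [← mk_eq_node _ _ _ (step s).2.2.length (fun i => unfold step ((step s).2.2.get i))]
  · exact PFunctor.M.corec_def (F := bohmFunctor K) _ _
  · apply List.ext_get <;> simp

/-- Bisimulation for the final coalgebra wants one shape with two child functions on it; since the
lists have equal length, the arguments of `N` can be indexed by the positions in `M.args`. -/
theorem eq_of_bisim (R : BohmTree K → BohmTree K → Prop)
    (hR : ∀ M N, R M N → M.lams = N.lams ∧ M.head = N.head ∧ List.Forall₂ R M.args N.args)
    {M N : BohmTree K} (h : R M N) : M = N := by
  refine PFunctor.M.bisim (P := bohmFunctor K) R (fun (M N : BohmTree K) hMN => ?_) M N h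
  obtain ⟨h₁, h₂, h₃⟩ := hR M N hMN
  obtain ⟨hl, hget⟩ := List.forall₂_iff_get.1 h₃
  let f : Fin M.args.length → BohmTree K := fun i => N.args.get (Fin.cast hl i)
  have hN : N = PFunctor.M.mk (F := bohmFunctor K) ⟨(M.lams, M.head, M.args.length), f⟩ := by
    refine ((mk_eq_node M.lams M.head N.args _ f ?_).trans ?_).symm
    · apply List.ext_get <;> simp [hl, f]
    · rw [h₁, h₂, node_eta N]
  refine ⟨(M.lams, M.head, M.args.length), M.args.get, f,
    (congrArg (PFunctor.M.dest (F := bohmFunctor K)) (node_eta M)).symm.trans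
      (PFunctor.M.dest_mk _),
    (congrArg (PFunctor.M.dest (F := bohmFunctor K)) hN).trans (PFunctor.M.dest_mk _),
    fun i : Fin M.args.length => hget i.1 i.2 (hl ▸ i.2)⟩

/-- Agreement of two trees up to depth `k`. -/
def AgreeUpTo : ℕ → BohmTree K → BohmTree K → Prop
  | 0, _, _ => True
  | k + 1, M, N => M.lams = N.lams ∧ M.head = N.head ∧
      List.Forall₂ (AgreeUpTo k) M.args N.args

theorem AgreeUpTo.mono {k : ℕ} : ∀ {M N : BohmTree K}, AgreeUpTo (k + 1) M N →
    AgreeUpTo k M N := by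
  induction k with
  | zero => exact fun _ => trivial
  | succ k ih => exact fun h => ⟨h.1, h.2.1, h.2.2.imp fun _ _ => ih⟩

theorem forall_forall₂ {α : Type u} {R : ℕ → α → α → Prop} : ∀ {l l' : List α},
    (∀ k, List.Forall₂ (R k) l l') → List.Forall₂ (fun x y => ∀ k, R k x y) l l'
  | [], [], _ => .nil
  | [], _ :: _, h => nomatch h 0
  | _ :: _, [], h => nomatch h 0
  | _ :: _, _ :: _, h => .cons (fun k => by cases h k; assumption)
      (forall_forall₂ fun k => by cases h k; assumption)

theorem eq_of_agreeUpTo {M N : BohmTree K} (h : ∀ k, AgreeUpTo k M N) : M = N := by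
  refine eq_of_bisim (fun M N => ∀ k, AgreeUpTo k M N) (fun M N h => ?_) h
  exact ⟨(h 1).1, (h 1).2.1, forall_forall₂ fun k => (h (k + 1)).2.2⟩

/-! ### Properties of all subtrees -/

/-- All subtrees of `M` at depth less than `k` have the property `Q`. -/
def AllUpTo (Q : BohmTree K → Prop) : ℕ → BohmTree K → Prop
  | 0, _ => True
  | k + 1, M => Q M ∧ ∀ L ∈ M.args, AllUpTo Q k L

theorem AllUpTo.mono {Q : BohmTree K → Prop} {k : ℕ} : ∀ {M : BohmTree K},
    AllUpTo Q (k + 1) M → AllUpTo Q k M := by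
  induction k with
  | zero => exact fun _ => trivial
  | succ k ih => exact fun h => ⟨h.1, fun L hL => ih (h.2 L hL)⟩

theorem AllUpTo.imp {Q Q' : BohmTree K → Prop} (hQ : ∀ M, Q M → Q' M) {k : ℕ} :
    ∀ {M : BohmTree K}, AllUpTo Q k M → AllUpTo Q' k M := by
  induction k with
  | zero => exact fun _ => trivial
  | succ k ih => exact fun h => ⟨hQ _ h.1, fun L hL => ih (h.2 L hL)⟩

theorem allUpTo_branch {Q : BohmTree K → Prop} {b : ℕ → BohmTree K}
    (hb : ∀ i, b (i + 1) ∈ (b i).args) (h : ∀ k, AllUpTo Q k (b 0)) (i : ℕ) : Q (b i) := by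
  have : ∀ i k, AllUpTo Q k (b i) := by
    intro i
    induction i with
    | zero => exact h
    | succ i ih => exact fun k => (ih (k + 1)).2 _ (hb i)
  exact (this i 1).1

/-! ### Infinite occurrence along traces -/

/-- The property `P` of heads holds infinitely often along each infinite trace. -/
def Often (P : Head K → Prop) (M : BohmTree K) : Prop :=
  ∀ T, IsInfTrace M T → ∀ N, ∃ i, N ≤ i ∧ P (T i)

/-- `L` is an argument of `M`, and the head of `M` does not have the property `P`. -/
def ArgAvoiding (P : Head K → Prop) (L M : BohmTree K) : Prop :=
  L ∈ M.args ∧ ¬ P M.head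

/-- Each infinite trace reaches `P`. -/
abbrev Reaches (P : Head K → Prop) (M : BohmTree K) : Prop := Acc (ArgAvoiding P) M

theorem reaches_iff {P : Head K → Prop} {M : BohmTree K} :
    Reaches P M ↔ P M.head ∨ ∀ L ∈ M.args, Reaches P L := by
  constructor
  · intro h
    by_cases hP : P M.head
    · exact .inl hP
    · exact .inr fun L hL => h.inv ⟨hL, hP⟩
  · rintro (h | h)
    · exact ⟨_, fun L hL => absurd h hL.2⟩
    · exact ⟨_, fun L hL => h L hL.1⟩

/-- As long as `P` fails, the branch descends along `ArgAvoiding P`, which accessibility permits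
only finitely often. -/
theorem Reaches.exists_branch {P : Head K → Prop} {b : ℕ → BohmTree K}
    (hb : ∀ i, b (i + 1) ∈ (b i).args) {M : BohmTree K} (h : Reaches P M) :
    ∀ N, b N = M → ∃ i, N ≤ i ∧ P (b i).head := by
  induction h with
  | intro M _ ih =>
    rintro N rfl
    by_cases hP : P (b N).head
    · exact ⟨N, le_rfl, hP⟩
    · obtain ⟨i, hi, hPi⟩ := ih _ ⟨hb N, hP⟩ (N + 1) rfl
      exact ⟨i, by omega, hPi⟩

theorem often_of_forall_reaches {P : Head K → Prop} {M : BohmTree K}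
    (h : ∀ k, AllUpTo (Reaches P) k M) : Often P M := by
  rintro T ⟨b, rfl, hb, hT⟩ N
  obtain ⟨i, hi, hP⟩ := (allUpTo_branch hb h N).exists_branch hb N rfl
  exact ⟨i, hi, hT i ▸ hP⟩

theorem Often.of_mem_args {P : Head K → Prop} {M L : BohmTree K} (h : Often P M)
    (hL : L ∈ M.args) : Often P L := by
  rintro T ⟨b, rfl, hb, hT⟩ N
  -- Prepending `M` to the branch shifts positions by one, hence the bound `N + 1`.
  obtain ⟨i, hi, hP⟩ := h (fun i => Nat.casesOn i M.head T)
    ⟨fun i => Nat.casesOn i M b, rfl, fun i => by cases i <;> simp [hL, hb],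
      fun i => by cases i <;> simp [hT]⟩ (N + 1)
  cases i with
  | zero => omega
  | succ i => exact ⟨i, by omega, hP⟩

theorem often_iff {P : Head K → Prop} {M : BohmTree K} :
    Often P M ↔ ∀ L ∈ M.args, Often P L := by
  refine ⟨fun h L hL => h.of_mem_args hL, ?_⟩
  rintro h T ⟨b, rfl, hb, hT⟩ N
  obtain ⟨i, hi, hP⟩ := h _ (hb 0) (fun i => T (i + 1))
    ⟨fun i => b (i + 1), rfl, fun i => hb (i + 1), fun i => hT (i + 1)⟩ N
  exact ⟨i + 1, by omega, hP⟩

/-- A tree that is not accessible has an argument that is not accessible, below a head without `P`.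
Iterating a choice of such arguments yields an infinite trace that avoids `P`. -/
theorem Often.reaches {P : Head K → Prop} {M : BohmTree K} (h : Often P M) : Reaches P M := by
  by_contra hM
  have step : ∀ x : {L : BohmTree K // ¬ Reaches P L},
      ∃ y : {L : BohmTree K // ¬ Reaches P L}, ArgAvoiding P y.1 x.1 := by
    rintro ⟨x, hx⟩
    by_contra hc
    exact hx ⟨_, fun y hy => by_contra fun hy' => hc ⟨⟨y, hy'⟩, hy⟩⟩
  choose f hf using step
  obtain ⟨i, -, hi⟩ := h (fun i => (f^[i] ⟨M, hM⟩).1.head)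
    ⟨fun i => (f^[i] ⟨M, hM⟩).1, rfl, fun i => by
      simpa only [Function.iterate_succ_apply'] using (hf _).1, fun _ => rfl⟩ 0
  exact (hf _).2 hi

/-! ### Scoping -/

theorem Occurs.of_arg {n : ℕ} {M L : BohmTree K} (hL : L ∈ M.args) {m : ℕ} {L' : BohmTree K}
    (h : Occurs (n + M.lams) L m L') : Occurs n M m L' := by
  induction h with
  | root => exact .arg .root hL
  | arg _ hL' ih => exact .arg ih hL'

theorem ScopedIn.head_lt {n : ℕ} {M : BohmTree K} (h : M.ScopedIn n) {i : ℕ}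
    (hi : M.head = Head.var i) : i < n + M.lams := h n M .root i hi

theorem ScopedIn.of_mem_args {n : ℕ} {M L : BohmTree K} (h : M.ScopedIn n) (hL : L ∈ M.args) :
    L.ScopedIn (n + M.lams) := fun m L' hL' => h m L' (hL'.of_arg hL)

/-- Coinduction for scoping: an invariant that bounds the head and passes to the arguments suffices.
-/
theorem scopedIn_of_closed {X : ℕ → BohmTree K → Prop}
    (hX : ∀ n M, X n M → (∀ i, M.head = Head.var i → i < n + M.lams) ∧
      ∀ L ∈ M.args, X (n + M.lams) L) {n : ℕ} {M : BohmTree K} (h : X n M) : M.ScopedIn n := by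
  have : ∀ m L, Occurs n M m L → X m L := by
    intro m L hL
    induction hL with
    | root => exact h
    | arg _ hL' ih => exact (hX _ _ ih).2 _ hL'
  exact fun m L hL => (hX _ _ (this m L hL)).1

end BohmTree

/-! ### Types without dependencies -/

section Expand

variable {F : Type v} {K : Type u}

theorem ArrowTy.shift_expand (d k : ℕ) (A : ArrowTy F) :
    (A.expand K k).shift d = A.expand K k := by
  cases k with
  | zero => simp [ArrowTy.expand, Ty.shift]
  | succ k =>
    induction A generalizing d with
    | fam a => simp [ArrowTy.expand, Ty.shift, SSp.shift]
    | arr B A ihB ihA => simp [ArrowTy.expand, Ty.shift, ihB, ihA]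

theorem ArrowTy.hSubTy_expand {k : ℕ} (N : Can K k) (j : ℕ) (τ : SimpleTy) (A : ArrowTy F) :
    HSubTy N j τ (A.expand K (k + 1)) (A.expand K (k + 1)) := by
  induction A generalizing j N with
  | fam a => exact .atom .nil
  | arr B A ihB ihA => exact .pi (ihB _ _) (ihA _ _)

/-- Substitution is a relation, so inverting a typing derivation needs uniqueness of its result
besides existence. -/
theorem ArrowTy.eq_of_hSubTy_expand {k : ℕ} {N : Can K k} {j : ℕ} {τ : SimpleTy} {A : ArrowTy F}
    {A' : Ty F K (k + 1)} (h : HSubTy N j τ (A.expand K (k + 1)) A') :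
    A' = A.expand K (k + 1) := by
  induction A generalizing j N A' with
  | fam a =>
    simp only [ArrowTy.expand] at h ⊢
    cases h with
    | atom h => cases h; rfl
  | arr B A ihB ihA =>
    simp only [ArrowTy.expand] at h ⊢
    cases h with
    | pi hB hA => rw [ihB hB, ihA hA]

theorem lookup_replicate_expand {k n i : ℕ} {A : ArrowTy F} {B : Ty F K k} :
    Lookup (List.replicate n (A.expand K k)) i B ↔ i < n ∧ B = A.expand K k := by
  constructor
  · induction n generalizing i B with
    | zero => intro h; cases h
    | succ n ih =>
      intro h
      rw [List.replicate_succ] at h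
      cases h with
      | zero => exact ⟨by omega, A.shift_expand _ _⟩
      | succ h =>
        obtain ⟨hi, rfl⟩ := ih h
        exact ⟨by omega, A.shift_expand _ _⟩
  · rintro ⟨hi, rfl⟩
    induction n generalizing i with
    | zero => omega
    | succ n ih =>
      rw [List.replicate_succ]
      cases i with
      | zero =>
        have h := Lookup.zero (Γ := List.replicate n (A.expand K k)) (A := A.expand K k)
        rwa [A.shift_expand] at h
      | succ i =>
        simpa only [A.shift_expand] using Lookup.succ (B := A.expand K k) (ih (i := i) (by omega))

end Expand

namespace Internal

variable {C : Type u}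

/-! ### Typing at a finite depth -/

/-- The context of `n` variables of type `vars` at depth `k`. -/
def varsCtxAt (C : Type u) (n k : ℕ) : List (Ty Fam (Con C) k) :=
  List.replicate n ((ArrowTy.fam Fam.vars).expand (Con C) k)

/-- The observation of `N` at depth `k` has the type `A` in the scope of `n` variables. -/
def TypedAt (k n : ℕ) (A : ArrowTy Fam) (N : BohmTree (Con C)) : Prop :=
  ∃ m : Can (Con C) k, Observe k N m ∧ CheckCan (sig C) (varsCtxAt C n k) m (A.expand (Con C) k)

/-- The list of arguments matches the domains of a type with target `a`. -/
def MatchArgs (Q : ArrowTy Fam → BohmTree (Con C) → Prop) (a : Fam) :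
    ArrowTy Fam → List (BohmTree (Con C)) → Prop
  | .fam b, [] => b = a
  | .arr B A, M :: Ms => Q B M ∧ MatchArgs Q a A Ms
  | _, _ => False

theorem typedAt_zero (n : ℕ) (A : ArrowTy Fam) (N : BohmTree (Con C)) : TypedAt 0 n A N :=
  ⟨.unobs, .zero N, .unobs⟩

theorem map_trunc_varsCtxAt (n k : ℕ) :
    (varsCtxAt C n (k + 1)).map Ty.trunc = varsCtxAt C n k := by
  have h := (ArrowTy.fam Fam.vars).trunc_expand (Con C) k
  rw [varsCtxAt, varsCtxAt, List.map_replicate]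
  exact congrArg _ h

/-- Without dependencies the type of the remaining spine does not vary with the argument, so typing
a spine splits into independent conditions on the arguments, each one depth lower. -/
theorem exists_synSSp_iff {k n : ℕ} {a : Fam} {A : ArrowTy Fam} {Ms : List (BohmTree (Con C))} :
    (∃ S, ObserveS k Ms S ∧ SynSSp (sig C) (varsCtxAt C n (k + 1)) S (A.expand (Con C) (k + 1))
      (.atom a .nil)) ↔ MatchArgs (TypedAt k n) a A Ms := by
  induction Ms generalizing A with
  | nil =>
    cases A with
    | fam b =>
      simp only [ArrowTy.expand, MatchArgs]
      constructor
      · rintro ⟨S, hS, h⟩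
        cases hS
        cases h
        rfl
      · rintro rfl
        exact ⟨_, .nil, .nil⟩
    | arr B A =>
      simp only [ArrowTy.expand, MatchArgs, iff_false]
      rintro ⟨S, hS, h⟩
      cases hS
      cases h
  | cons M Ms ih =>
    cases A with
    | fam b =>
      simp only [ArrowTy.expand, MatchArgs, iff_false]
      rintro ⟨S, hS, h⟩
      cases hS
      cases h
    | arr B A =>
      simp only [ArrowTy.expand, MatchArgs, ← ih]
      constructor
      · rintro ⟨S, hS, h⟩
        cases hS with
        | cons hM hS =>
          cases h with
          | cons hc hs h =>
            cases A.eq_of_hSubTy_expand hs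
            rw [map_trunc_varsCtxAt] at hc
            have e := B.trunc_expand (Con C) k
            exact ⟨⟨_, hM, e ▸ hc⟩, _, hS, h⟩
      · rintro ⟨⟨m, hM, hc⟩, S, hS, h⟩
        refine ⟨.cons m S, .cons hM hS, .cons ?_ (A.hSubTy_expand _ _ _) h⟩
        rw [map_trunc_varsCtxAt]
        have e := B.trunc_expand (Con C) k
        exact e.symm ▸ hc

/-- An atomic type leaves no room for abstractions. All variables in scope have the atomic type
`vars`, so a variable head takes no arguments. -/
theorem typedAt_fam_iff {k n : ℕ} {a : Fam} {N : BohmTree (Con C)} :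
    TypedAt (k + 1) n (.fam a) N ↔ N.lams = 0 ∧
      ((∃ i, i < n ∧ N.head = .var i ∧ a = .vars ∧ N.args = []) ∨
        ∃ c, N.head = .con c ∧ MatchArgs (TypedAt k n) a (conTy c) N.args) := by
  simp only [← exists_synSSp_iff]
  constructor
  · rintro ⟨m, hm, h⟩
    simp only [ArrowTy.expand] at h
    generalize hl : N.lams = l
    cases hm with
    | var hh hT =>
      rw [hl] at h
      cases l with
      | succ l => cases h
      | zero =>
        refine ⟨rfl, .inl ?_⟩
        cases h with
        | neu h =>
          cases h with
          | var hL h =>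
            obtain ⟨hi, rfl⟩ := lookup_replicate_expand.1 hL
            simp only [ArrowTy.expand] at h
            cases h
            generalize N.args = Ms at hT
            cases hT
            exact ⟨_, hi, hh, rfl, rfl⟩
    | con hh hS =>
      rw [hl] at h
      cases l with
      | succ l => cases h
      | zero =>
        refine ⟨rfl, .inr ?_⟩
        cases h with
        | neu h =>
          cases h with
          | con h => exact ⟨_, hh, _, hS, h⟩
  · rintro ⟨hl, ⟨i, hi, hh, rfl, ha⟩ | ⟨c, hh, S, hS, h⟩⟩
    · have ho := Observe.var (k := k) (T := .nil) hh (by rw [ha]; exact .nil)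
      rw [hl] at ho
      exact ⟨_, ho, .neu (.var (lookup_replicate_expand.2 ⟨hi, rfl⟩) .nil)⟩
    · have ho := Observe.con (k := k) hh hS
      rw [hl] at ho
      exact ⟨_, ho, .neu (.con h)⟩

/-- An abstraction costs no observation depth; it only extends the context by one more `vars`. -/
theorem typedAt_abs_iff {k n : ℕ} {A : ArrowTy Fam} {N : BohmTree (Con C)} :
    TypedAt (k + 1) n (.arr (.fam .vars) A) (abs N) ↔ TypedAt (k + 1) (n + 1) A N := by
  constructor
  · rintro ⟨m, hm, h⟩
    simp only [ArrowTy.expand] at h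
    cases hm with
    | var hh hT =>
      cases h with
      | lam h => exact ⟨_, .var hh (by simpa [abs] using hT), h⟩
    | con hh hS =>
      cases h with
      | lam h => exact ⟨_, .con hh (by simpa [abs] using hS), h⟩
  · rintro ⟨m, hm, h⟩
    cases hm with
    | var hh hT =>
      exact ⟨_, .var (M := abs N) hh (by simpa [abs] using hT), .lam h⟩
    | con hh hS =>
      exact ⟨_, .con (M := abs N) hh (by simpa [abs] using hS), .lam h⟩

theorem TypedAt.exists_eq_abs {k n : ℕ} {B A : ArrowTy Fam} {N : BohmTree (Con C)}
    (h : TypedAt (k + 1) n (.arr B A) N) : ∃ N', N = abs N' := by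
  obtain ⟨m, hm, h⟩ := h
  simp only [ArrowTy.expand] at h
  suffices hl : N.lams ≠ 0 by
    refine ⟨.node (N.lams - 1) N.head N.args, ?_⟩
    rw [abs, BohmTree.lams_node, BohmTree.head_node, BohmTree.args_node,
      Nat.sub_add_cancel (by omega), BohmTree.node_eta]
  intro hl
  cases hm <;> rw [hl] at h <;> cases h

end Internal

namespace Internal

open BohmTree

variable {C : Type u}

/-! ### The constructors of encodings -/

@[simp] theorem lams_app (c : Con C) (Ms : List (BohmTree (Con C))) : (app c Ms).lams = 0 := rfl

@[simp] theorem head_app (c : Con C) (Ms : List (BohmTree (Con C))) :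
    (app c Ms).head = .con c := rfl

@[simp] theorem args_app (c : Con C) (Ms : List (BohmTree (Con C))) : (app c Ms).args = Ms :=
  args_node _ _ _

@[simp] theorem lams_abs (M : BohmTree (Con C)) : (abs M).lams = M.lams + 1 := rfl

@[simp] theorem head_abs (M : BohmTree (Con C)) : (abs M).head = M.head := rfl

@[simp] theorem args_abs (M : BohmTree (Con C)) : (abs M).args = M.args := args_node _ _ _

@[simp] theorem app_inj {c c' : Con C} {Ms Ms' : List (BohmTree (Con C))} :
    app c Ms = app c' Ms' ↔ c = c' ∧ Ms = Ms' := by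
  simp [app, node_inj]

@[simp] theorem abs_inj {M M' : BohmTree (Con C)} : abs M = abs M' ↔ M = M' := by
  refine ⟨fun h => ?_, fun h => h ▸ rfl⟩
  obtain ⟨h₁, h₂, h₃⟩ := node_inj.1 h
  rw [← node_eta M, ← node_eta M', Nat.succ_injective h₁, h₂, h₃]

/-- The encoding of a node whose arguments are encoded by `Ms`. -/
def encNode (l : ℕ) (h : Head C) (Ms : List (BohmTree (Con C))) : BohmTree (Con C) :=
  lamN l (app .base [neutral h Ms])

@[simp] theorem encNode_zero (h : Head C) (Ms : List (BohmTree (Con C))) :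
    encNode 0 h Ms = app .base [neutral h Ms] := rfl

@[simp] theorem encNode_succ (l : ℕ) (h : Head C) (Ms : List (BohmTree (Con C))) :
    encNode (l + 1) h Ms = app .lam [abs (encNode l h Ms)] := rfl

theorem lams_encNode (l : ℕ) (h : Head C) (Ms : List (BohmTree (Con C))) :
    (encNode l h Ms).lams = 0 := by
  cases l <;> rfl

theorem tSpine_injective : Function.Injective (tSpine (C := C)) := by
  intro Ms
  induction Ms with
  | nil => intro Ms' h; cases Ms' <;> simp_all [tSpine]
  | cons M Ms ih =>
    intro Ms' h
    cases Ms' with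
    | nil => simp [tSpine] at h
    | cons M' Ms' =>
      simp only [tSpine, app_inj, List.cons.injEq, and_true, true_and] at h
      rw [h.1, ih h.2]

theorem sSpine_injective : Function.Injective (sSpine (C := C)) := by
  intro Ms
  induction Ms with
  | nil => intro Ms' h; cases Ms' <;> simp_all [sSpine]
  | cons M Ms ih =>
    intro Ms' h
    cases Ms' with
    | nil => simp [sSpine] at h
    | cons M' Ms' =>
      simp only [sSpine, app_inj, List.cons.injEq, and_true, true_and] at h
      rw [h.1, ih h.2]

theorem neutral_inj {h h' : Head C} {Ms Ms' : List (BohmTree (Con C))} :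
    neutral h Ms = neutral h' Ms' ↔ h = h' ∧ Ms = Ms' := by
  cases h <;> cases h' <;>
    simp [neutral, node_inj, tSpine_injective.eq_iff, sSpine_injective.eq_iff]

/-- The outermost constructor, `lam` or `base`, tells whether abstractions remain. -/
theorem encNode_inj {l l' : ℕ} {h h' : Head C} {Ms Ms' : List (BohmTree (Con C))} :
    encNode l h Ms = encNode l' h' Ms' ↔ l = l' ∧ h = h' ∧ Ms = Ms' := by
  induction l generalizing l' with
  | zero => cases l' <;> simp [neutral_inj]
  | succ l ih => cases l' <;> simp [ih]

/-! ### Existence of the encoding -/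

/-- The states of the corecursive definition of the encoding. -/
inductive EncState (C : Type u) : Type u
  -- `b` counts the framework abstractions in front: `1` for the argument `[x] …` of a `lam`, `0`
  -- elsewhere.
  | tm (b l : ℕ) (h : Head C) (Ms : List (BohmTree C))
  | neu (h : Head C) (Ms : List (BohmTree C))
  | var (i : ℕ)
  | const (c : C)
  | tSp (Ms : List (BohmTree C))
  | sSp (Ms : List (BohmTree C))
  | prog (M : BohmTree C)

/-- The state that generates the encoding of `M`. -/
def EncState.ofTree (M : BohmTree C) : EncState C := .tm 0 M.lams M.head M.args

/-- The corecursive definition of the encoding. -/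
def EncState.step : EncState C → ℕ × Head (Con C) × List (EncState C)
  | .tm b 0 h Ms => (b, .con .base, [.neu h Ms])
  | .tm b (l + 1) h Ms => (b, .con .lam, [.tm 1 l h Ms])
  | .neu (.var i) Ms => (0, .con .varntm, [.var i, .tSp Ms])
  | .neu (.con c) Ms => (0, .con .constntm, [.const c, .sSp Ms])
  | .var i => (0, .var i, [])
  | .const c => (0, .con (.const c), [])
  | .tSp [] => (0, .con .tnil, [])
  | .tSp (M :: Ms) => (0, .con .tcons, [.ofTree M, .tSp Ms])
  | .sSp [] => (0, .con .snil, [])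
  | .sSp (M :: Ms) => (0, .con .scons, [.prog M, .sSp Ms])
  | .prog M => (0, .con .progress, [.ofTree M])

/-- The encoding of trees. -/
def encode (M : BohmTree C) : BohmTree (Con C) := unfold EncState.step (.ofTree M)

theorem unfold_tSp (Ms : List (BohmTree C)) :
    unfold EncState.step (.tSp Ms) = tSpine (Ms.map encode) := by
  induction Ms with
  | nil => rw [unfold_eq]; rfl
  | cons M Ms ih =>
    rw [unfold_eq]
    simp only [EncState.step, List.map_cons, List.map_nil, ih]
    rfl

theorem unfold_prog (M : BohmTree C) :
    unfold EncState.step (.prog M) = app .progress [encode M] := by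
  rw [unfold_eq]; rfl

theorem unfold_sSp (Ms : List (BohmTree C)) :
    unfold EncState.step (.sSp Ms) = sSpine (Ms.map encode) := by
  induction Ms with
  | nil => rw [unfold_eq]; rfl
  | cons M Ms ih =>
    rw [unfold_eq]
    simp only [EncState.step, List.map_cons, List.map_nil, ih, unfold_prog]
    rfl

theorem unfold_neu (h : Head C) (Ms : List (BohmTree C)) :
    unfold EncState.step (.neu h Ms) = neutral h (Ms.map encode) := by
  rw [unfold_eq]
  cases h with
  | var i =>
    have : unfold EncState.step (.var i : EncState C) = node 0 (.var i) [] := unfold_eq _ _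
    simp only [EncState.step, List.map_cons, List.map_nil, unfold_tSp, this]
    rfl
  | con c =>
    have : unfold EncState.step (.const c : EncState C) = app (.const c) [] := unfold_eq _ _
    simp only [EncState.step, List.map_cons, List.map_nil, unfold_sSp, this]
    rfl

/-- An encoded node has no framework abstractions of its own; the state adds `b` of them. The
induction step uses `b = 1`, so `b` is kept general. -/
theorem unfold_tm (b l : ℕ) (h : Head C) (Ms : List (BohmTree C)) :
    unfold EncState.step (.tm b l h Ms) =
      node b (encNode l h (Ms.map encode)).head (encNode l h (Ms.map encode)).args := by
  rw [unfold_eq]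
  induction l generalizing b with
  | zero => simp [EncState.step, unfold_neu]
  | succ l ih =>
    have := ih 1
    rw [← unfold_eq] at this
    simp [EncState.step, this, abs, lams_encNode]

theorem isEncoding_encode : IsEncoding (encode (C := C)) := by
  intro l h Ms
  change unfold EncState.step (.tm 0 l h (node l h Ms).args) = encNode l h (Ms.map encode)
  rw [unfold_tm, args_node]
  conv_rhs => rw [← node_eta (encNode l h (Ms.map encode)), lams_encNode]

-- Injectivity of encodings

theorem IsEncoding.eq_encNode {enc : BohmTree C → BohmTree (Con C)} (he : IsEncoding enc)
    (M : BohmTree C) : enc M = encNode M.lams M.head (M.args.map enc) := by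
  conv_lhs => rw [← node_eta M]
  exact he _ _ _

theorem IsEncoding.injective {enc : BohmTree C → BohmTree (Con C)} (he : IsEncoding enc) :
    Function.Injective enc := by
  intro M M' h
  refine eq_of_bisim (fun M M' => enc M = enc M') (fun M M' h => ?_) h
  rw [he.eq_encNode M, he.eq_encNode M', encNode_inj] at h
  refine ⟨h.1, h.2.1, ?_⟩
  have := h.2.2
  rwa [← List.forall₂_eq_eq_eq, List.forall₂_map_left_iff, List.forall₂_map_right_iff] at this

end Internal

namespace Internal

open BohmTree

variable {C : Type u}

/-! ### Encodings are well typed -/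

@[simp] theorem typedAt_app_iff {k n : ℕ} {a : Fam} {c : Con C} {Ms : List (BohmTree (Con C))} :
    TypedAt (k + 1) n (.fam a) (app c Ms) ↔ MatchArgs (TypedAt k n) a (conTy c) Ms := by
  simp [typedAt_fam_iff]

/-- `tcons` is a constant, so the entries are seen at depths strictly below `k`; this is what makes
strong induction on the depth go through. -/
theorem typedAt_tSpine {k n : ℕ} {Ms : List (BohmTree (Con C))}
    (h : ∀ j < k, ∀ M ∈ Ms, TypedAt j n (.fam .ctm) M) :
    TypedAt k n (.fam .tSpine) (tSpine Ms) := by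
  induction Ms generalizing k with
  | nil => cases k <;> simp [typedAt_zero, tSpine, conTy, MatchArgs]
  | cons M Ms ih =>
    cases k with
    | zero => exact typedAt_zero _ _ _
    | succ k =>
      simp only [tSpine, typedAt_app_iff, conTy, MatchArgs, and_true]
      exact ⟨h k (by omega) M (by simp), ih fun j hj M' hM' => h j (by omega) M' (by simp [hM'])⟩

theorem typedAt_sSpine {k n : ℕ} {Ms : List (BohmTree (Con C))}
    (h : ∀ j < k, ∀ M ∈ Ms, TypedAt j n (.fam .ctm) M) :
    TypedAt k n (.fam .sSpine) (sSpine Ms) := by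
  induction Ms generalizing k with
  | nil => cases k <;> simp [typedAt_zero, sSpine, conTy, MatchArgs]
  | cons M Ms ih =>
    cases k with
    | zero => exact typedAt_zero _ _ _
    | succ k =>
      simp only [sSpine, typedAt_app_iff, conTy, MatchArgs, and_true]
      refine ⟨?_, ih fun j hj M' hM' => h j (by omega) M' (by simp [hM'])⟩
      cases k with
      | zero => exact typedAt_zero _ _ _
      | succ k =>
        simpa only [typedAt_app_iff, conTy, MatchArgs, and_true] using h k (by omega) M (by simp)

theorem typedAt_neutral {k n : ℕ} {h : Head C} {Ms : List (BohmTree (Con C))}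
    (hh : ∀ i, h = .var i → i < n) (hM : ∀ j < k, ∀ M ∈ Ms, TypedAt j n (.fam .ctm) M) :
    TypedAt k n (.fam .ntm) (neutral h Ms) := by
  cases k with
  | zero => exact typedAt_zero _ _ _
  | succ k =>
    have hM' : ∀ j < k, ∀ M ∈ Ms, TypedAt j n (.fam .ctm) M := fun j hj => hM j (by omega)
    cases h with
    | var i =>
      simp only [neutral, typedAt_app_iff, conTy, MatchArgs, and_true]
      refine ⟨?_, typedAt_tSpine hM'⟩
      cases k <;> simp [typedAt_zero, typedAt_fam_iff, hh]
    | con c =>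
      simp only [neutral, typedAt_app_iff, conTy, MatchArgs, and_true]
      refine ⟨?_, typedAt_sSpine hM'⟩
      cases k <;> simp [typedAt_zero, conTy, MatchArgs]

theorem typedAt_encNode {k n l : ℕ} {h : Head C} {Ms : List (BohmTree (Con C))}
    (hh : ∀ i, h = .var i → i < n + l)
    (hM : ∀ j < k, ∀ M ∈ Ms, TypedAt j (n + l) (.fam .ctm) M) :
    TypedAt k n (.fam .ctm) (encNode l h Ms) := by
  induction l generalizing n k with
  | zero =>
    cases k with
    | zero => exact typedAt_zero _ _ _
    | succ k =>
      simp only [encNode_zero, typedAt_app_iff, conTy, MatchArgs, and_true]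
      exact typedAt_neutral hh fun j hj => hM j (by omega)
  | succ l ih =>
    match k with
    | 0 => exact typedAt_zero _ _ _
    -- Depth `1` shows only the `lam`; its argument is unobserved, and `typedAt_abs_iff` needs
    -- positive depth.
    | 1 => simp [typedAt_zero, conTy, MatchArgs]
    | k + 2 =>
      simp only [encNode_succ, typedAt_app_iff, typedAt_abs_iff, conTy, MatchArgs, and_true]
      have e : n + 1 + l = n + (l + 1) := by omega
      exact ih (e ▸ hh) fun j hj => e ▸ hM j (by omega)

theorem IsEncoding.typedAt {enc : BohmTree C → BohmTree (Con C)} (he : IsEncoding enc) (k : ℕ) :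
    ∀ {n : ℕ} {M : BohmTree C}, M.ScopedIn n → TypedAt k n (.fam .ctm) (enc M) := by
  induction k using Nat.strong_induction_on with
  | _ k ih =>
    intro n M hM
    rw [he.eq_encNode]
    refine typedAt_encNode (fun i => hM.head_lt) fun j hj N hN => ?_
    obtain ⟨L, hL, rfl⟩ := List.mem_map.1 hN
    exact ih j hj (hM.of_mem_args hL)

/-! ### Inversion of typing -/

/-- `N` has the type `A` in the scope of `n` variables, at every depth. -/
def Typed (n : ℕ) (A : ArrowTy Fam) (N : BohmTree (Con C)) : Prop :=
  ∀ k, TypedAt k n A N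

theorem forall_matchArgs_iff {Q : ℕ → ArrowTy Fam → BohmTree (Con C) → Prop} {a : Fam}
    {A : ArrowTy Fam} {Ms : List (BohmTree (Con C))} :
    (∀ k, MatchArgs (Q k) a A Ms) ↔ MatchArgs (fun A M => ∀ k, Q k A M) a A Ms := by
  induction Ms generalizing A with
  | nil => cases A <;> simp [MatchArgs]
  | cons M Ms ih => cases A <;> simp [MatchArgs, forall_and, ih]

-- Passing to all depths absorbs the loss of one depth below a constant, since depth `0` carries no
-- condition.
@[simp] theorem typed_app_iff {n : ℕ} {a : Fam} {c : Con C} {Ms : List (BohmTree (Con C))} :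
    Typed n (.fam a) (app c Ms) ↔ MatchArgs (Typed n) a (conTy c) Ms := by
  change _ ↔ MatchArgs (fun A M => ∀ k, TypedAt k n A M) a (conTy c) Ms
  simp only [← forall_matchArgs_iff, ← typedAt_app_iff]
  exact ⟨fun h k => h (k + 1), fun h k => k.casesOn (typedAt_zero _ _ _) h⟩

@[simp] theorem typed_abs_iff {n : ℕ} {A : ArrowTy Fam} {N : BohmTree (Con C)} :
    Typed n (.arr (.fam .vars) A) (abs N) ↔ Typed (n + 1) A N := by
  constructor <;> intro h k <;> cases k
  · exact typedAt_zero _ _ _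
  · exact typedAt_abs_iff.1 (h _)
  · exact typedAt_zero _ _ _
  · exact typedAt_abs_iff.2 (h _)

theorem Typed.eq_var_or_eq_app {n : ℕ} {a : Fam} {N : BohmTree (Con C)}
    (h : Typed n (.fam a) N) : a = .vars ∨ ∃ c Ms, N = app c Ms ∧
      MatchArgs (Typed n) a (conTy c) Ms := by
  obtain ⟨hl, ⟨i, -, -, ha, -⟩ | ⟨c, hc, -⟩⟩ := typedAt_fam_iff.1 (h 1)
  · exact .inl ha
  · have e : N = app c N.args := by
      conv_lhs => rw [← node_eta N, hl, hc]
      rfl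
    rw [e, typed_app_iff] at h
    exact .inr ⟨c, _, e, h⟩

theorem typed_var_iff {n i : ℕ} {a : Fam} :
    Typed (C := C) n (.fam a) (node 0 (.var i) []) ↔ i < n ∧ a = .vars := by
  constructor
  · intro h
    simpa [typedAt_fam_iff] using h 1
  · rintro ⟨hi, rfl⟩ (_ | k)
    · exact typedAt_zero _ _ _
    · simp [typedAt_fam_iff, hi]

theorem typed_tSpine_iff {n : ℕ} {Ms : List (BohmTree (Con C))} :
    Typed n (.fam .tSpine) (tSpine Ms) ↔ ∀ M ∈ Ms, Typed n (.fam .ctm) M := by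
  induction Ms with
  | nil => simp [tSpine, conTy, MatchArgs]
  | cons M Ms ih => simp [tSpine, conTy, MatchArgs, ih]

theorem typed_sSpine_iff {n : ℕ} {Ms : List (BohmTree (Con C))} :
    Typed n (.fam .sSpine) (sSpine Ms) ↔ ∀ M ∈ Ms, Typed n (.fam .ctm) M := by
  induction Ms with
  | nil => simp [sSpine, conTy, MatchArgs]
  | cons M Ms ih => simp [sSpine, conTy, MatchArgs, ih]

theorem typed_neutral_iff {n : ℕ} {h : Head C} {Ms : List (BohmTree (Con C))} :
    Typed n (.fam .ntm) (neutral h Ms) ↔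
      (∀ i, h = .var i → i < n) ∧ ∀ M ∈ Ms, Typed n (.fam .ctm) M := by
  cases h <;> simp [neutral, conTy, MatchArgs, typed_var_iff, typed_tSpine_iff, typed_sSpine_iff]

theorem typed_encNode_iff {n l : ℕ} {h : Head C} {Ms : List (BohmTree (Con C))} :
    Typed n (.fam .ctm) (encNode l h Ms) ↔
      (∀ i, h = .var i → i < n + l) ∧ ∀ M ∈ Ms, Typed (n + l) (.fam .ctm) M := by
  induction l generalizing n with
  | zero => simp [conTy, MatchArgs, typed_neutral_iff]
  | succ l ih =>
    have e : n + 1 + l = n + (l + 1) := by omega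
    simp [conTy, MatchArgs, ih, e]

theorem IsEncoding.scopedIn {enc : BohmTree C → BohmTree (Con C)} (he : IsEncoding enc) {n : ℕ}
    {M : BohmTree C} (h : Typed n (.fam .ctm) (enc M)) : M.ScopedIn n := by
  refine scopedIn_of_closed (X := fun n M => Typed n (.fam .ctm) (enc M)) (fun n M h => ?_) h
  rw [he.eq_encNode, typed_encNode_iff] at h
  exact ⟨h.1, fun L hL => h.2 _ (List.mem_map_of_mem hL)⟩

/-! ### Shape of well-typed trees -/

/-- The head is the coinductive constructor. -/
def IsProgress (h : Head (Con C)) : Prop := h = .con .progress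

/-- Typing leaves `tnil` and `tcons`. The tail lies below a head other than `progress`, so
accessibility rules out an infinite chain of `tcons`. -/
theorem exists_eq_tSpine {n : ℕ} {N : BohmTree (Con C)} (hr : Reaches IsProgress N)
    (h : Typed n (.fam .tSpine) N) : ∃ Ms, N = tSpine Ms := by
  induction hr with
  | intro N _ ih =>
    obtain h | ⟨c, Ms, rfl, h⟩ := h.eq_var_or_eq_app
    · cases h
    -- No declared constant takes more than two arguments, so longer lists need no further
    -- splitting.
    · cases c <;> rcases Ms with _ | ⟨M, _ | ⟨M', _ | _⟩⟩ <;> simp [conTy, MatchArgs] at h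
      · exact ⟨[], rfl⟩
      · obtain ⟨Ms, rfl⟩ := ih M' ⟨by simp, by simp [IsProgress]⟩ h.2
        exact ⟨M :: Ms, rfl⟩

theorem exists_eq_progress {n : ℕ} {N : BohmTree (Con C)} (h : Typed n (.fam .pCtm) N) :
    ∃ M, N = app .progress [M] := by
  obtain h | ⟨c, Ms, rfl, h⟩ := h.eq_var_or_eq_app
  · cases h
  · cases c <;> rcases Ms with _ | ⟨M, _ | ⟨M', _ | _⟩⟩ <;> simp [conTy, MatchArgs] at h
    exact ⟨M, rfl⟩

theorem exists_eq_const {n : ℕ} {N : BohmTree (Con C)} (h : Typed n (.fam .consts) N) :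
    ∃ c, N = app (.const c) [] := by
  obtain h | ⟨c, Ms, rfl, h⟩ := h.eq_var_or_eq_app
  · cases h
  · cases c <;> rcases Ms with _ | ⟨M, _ | ⟨M', _ | _⟩⟩ <;> simp [conTy, MatchArgs] at h
    exact ⟨_, rfl⟩

/-- `progress` guards the entries of the spine but not its tail, so accessibility still bounds the
chain of `scons`. -/
theorem exists_eq_sSpine {n : ℕ} {N : BohmTree (Con C)} (hr : Reaches IsProgress N)
    (h : Typed n (.fam .sSpine) N) : ∃ Ms, N = sSpine Ms := by
  induction hr with
  | intro N _ ih =>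
    obtain h | ⟨c, Ms, rfl, h⟩ := h.eq_var_or_eq_app
    · cases h
    · cases c <;> rcases Ms with _ | ⟨M, _ | ⟨M', _ | _⟩⟩ <;> simp [conTy, MatchArgs] at h
      · exact ⟨[], rfl⟩
      · obtain ⟨M, rfl⟩ := exists_eq_progress h.1
        obtain ⟨Ms, rfl⟩ := ih M' ⟨by simp, by simp [IsProgress]⟩ h.2
        exact ⟨M :: Ms, rfl⟩

theorem exists_eq_var {n : ℕ} {N : BohmTree (Con C)} (h : Typed n (.fam .vars) N) :
    ∃ i, N = node 0 (.var i) [] := by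
  obtain ⟨hl, ⟨i, -, hi, -, ha⟩ | ⟨c, -, hc⟩⟩ := typedAt_fam_iff.1 (h 1)
  · refine ⟨i, ?_⟩
    rw [← node_eta N, hl, hi, ha]
  · generalize N.args = Ms at hc
    cases c <;> rcases Ms with _ | ⟨M, _ | ⟨M', _ | _⟩⟩ <;> simp [conTy, MatchArgs] at hc

theorem exists_eq_neutral {n : ℕ} {N : BohmTree (Con C)} (hr : Reaches IsProgress N)
    (h : Typed n (.fam .ntm) N) : ∃ h Ms, N = neutral h Ms := by
  obtain h | ⟨c, Ms, rfl, h⟩ := h.eq_var_or_eq_app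
  · cases h
  · rw [reaches_iff] at hr
    cases c <;> rcases Ms with _ | ⟨M, _ | ⟨M', _ | _⟩⟩ <;> simp [conTy, MatchArgs] at h
    · obtain ⟨i, rfl⟩ := exists_eq_var h.1
      obtain ⟨Ms, rfl⟩ := exists_eq_tSpine
        (hr.resolve_left (by simp [IsProgress]) M' (by simp)) h.2
      exact ⟨.var i, Ms, rfl⟩
    · obtain ⟨c, rfl⟩ := exists_eq_const h.1
      obtain ⟨Ms, rfl⟩ := exists_eq_sSpine
        (hr.resolve_left (by simp [IsProgress]) M' (by simp)) h.2
      exact ⟨.con c, Ms, rfl⟩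

/-- The argument of `lam` is `abs L`, while the type `ctm` belongs to `L`. The induction must follow
the actual subtree, so the statement covers both forms; `abs` changes neither head nor arguments. -/
theorem exists_eq_encNode {N : BohmTree (Con C)} (hr : Reaches IsProgress N) :
    ∀ {n : ℕ} {L : BohmTree (Con C)}, N = L ∨ N = abs L → Typed n (.fam .ctm) L →
      ∃ l h Ms, L = encNode l h Ms := by
  induction hr with
  | intro N hN ih =>
    intro n L hL h
    have hh : N.head = L.head := by obtain rfl | rfl := hL <;> simp
    have ha : N.args = L.args := by obtain rfl | rfl := hL <;> simp
    obtain h | ⟨c, Ms, rfl, h⟩ := h.eq_var_or_eq_app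
    · cases h
    · have hA : ¬ c = .progress → ∀ M ∈ Ms, ArgAvoiding IsProgress M N := fun hc M hM =>
        ⟨by simpa [ha] using hM, by simpa [hh, IsProgress] using hc⟩
      cases c <;> rcases Ms with _ | ⟨M, _ | ⟨M', _ | _⟩⟩ <;> simp [conTy, MatchArgs] at h
      · obtain ⟨M, rfl⟩ := (h 1).exists_eq_abs
        obtain ⟨l, hd, Ms, rfl⟩ := ih _ (hA (by simp) _ (by simp)) (.inr rfl) (typed_abs_iff.1 h)
        exact ⟨l + 1, hd, Ms, rfl⟩
      · obtain ⟨hd, Ms, rfl⟩ := exists_eq_neutral (hN _ (hA (by simp) _ (by simp))) h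
        exact ⟨0, hd, Ms, rfl⟩

end Internal

namespace Internal

open BohmTree

variable {C : Type u}

/-! ### Decoding -/

open Classical in
/-- The corecursive definition of decoding. -/
noncomputable def decodeStep (N : BohmTree (Con C)) : ℕ × Head C × List (BohmTree (Con C)) :=
  if h : ∃ x : ℕ × Head C × List (BohmTree (Con C)), N = encNode x.1 x.2.1 x.2.2 then h.choose
  -- Arbitrary value, never reached from a typed tree of type `ctm` whose infinite traces contain
  -- `progress` infinitely often.
  else (0, .var 0, [])

/-- The tree that is encoded by `N`, if there is one. -/
noncomputable def decode : BohmTree (Con C) → BohmTree C := unfold decodeStep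

theorem decode_encNode (l : ℕ) (h : Head C) (Ms : List (BohmTree (Con C))) :
    decode (encNode l h Ms) = node l h (Ms.map decode) := by
  have hs : decodeStep (encNode l h Ms) = (l, h, Ms) := by
    have hx : ∃ x : ℕ × Head C × List (BohmTree (Con C)),
        encNode l h Ms = encNode x.1 x.2.1 x.2.2 := ⟨(l, h, Ms), rfl⟩
    rw [decodeStep, dif_pos hx]
    obtain ⟨h₁, h₂, h₃⟩ := encNode_inj.1 hx.choose_spec
    exact Prod.ext h₁.symm (Prod.ext h₂.symm h₃.symm)
  rw [decode, unfold_eq, hs]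

-- Agreement and infinite occurrence for encoded nodes

theorem agreeUpTo_app {k : ℕ} {c : Con C} {Ms Ms' : List (BohmTree (Con C))}
    (h : List.Forall₂ (AgreeUpTo k) Ms Ms') : AgreeUpTo (k + 1) (app c Ms) (app c Ms') :=
  ⟨rfl, rfl, by simpa using h⟩

theorem agreeUpTo_abs {k : ℕ} {M M' : BohmTree (Con C)} (h : AgreeUpTo k M M') :
    AgreeUpTo k (abs M) (abs M') := by
  cases k with
  | zero => trivial
  | succ k => exact ⟨by simp [h.1], by simp [h.2.1], by simpa using h.2.2⟩

theorem agreeUpTo_refl (k : ℕ) (M : BohmTree (Con C)) : AgreeUpTo k M M := by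
  induction k generalizing M with
  | zero => trivial
  | succ k ih => exact ⟨rfl, rfl, List.forall₂_same.2 fun L _ => ih L⟩

theorem agreeUpTo_tSpine {k : ℕ} {Ms Ms' : List (BohmTree (Con C))}
    (h : List.Forall₂ (AgreeUpTo k) Ms Ms') : AgreeUpTo k (tSpine Ms) (tSpine Ms') := by
  induction h with
  | nil => exact agreeUpTo_refl _ _
  | cons hM _ ih => exact (agreeUpTo_app (.cons hM (.cons ih .nil))).mono

theorem agreeUpTo_sSpine {k : ℕ} {Ms Ms' : List (BohmTree (Con C))}
    (h : List.Forall₂ (AgreeUpTo k) Ms Ms') : AgreeUpTo k (sSpine Ms) (sSpine Ms') := by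
  induction h with
  | nil => exact agreeUpTo_refl _ _
  | cons hM _ ih =>
    exact (agreeUpTo_app (.cons (agreeUpTo_app (.cons hM .nil)).mono (.cons ih .nil))).mono

theorem agreeUpTo_neutral {k : ℕ} (h : Head C) {Ms Ms' : List (BohmTree (Con C))}
    (hM : List.Forall₂ (AgreeUpTo k) Ms Ms') : AgreeUpTo k (neutral h Ms) (neutral h Ms') := by
  cases h with
  | var i =>
    exact (agreeUpTo_app (.cons (agreeUpTo_refl _ _) (.cons (agreeUpTo_tSpine hM) .nil))).mono
  | con c =>
    exact (agreeUpTo_app (.cons (agreeUpTo_refl _ _) (.cons (agreeUpTo_sSpine hM) .nil))).mono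

/-- The block is at least one level high. This gain of one level drives the induction in
`IsEncoding.agreeUpTo_decode`; further levels are given up by `AgreeUpTo.mono`. -/
theorem agreeUpTo_encNode {k : ℕ} (l : ℕ) (h : Head C) {Ms Ms' : List (BohmTree (Con C))}
    (hM : List.Forall₂ (AgreeUpTo k) Ms Ms') :
    AgreeUpTo (k + 1) (encNode l h Ms) (encNode l h Ms') := by
  induction l with
  | zero => exact agreeUpTo_app (.cons (agreeUpTo_neutral h hM) .nil)
  | succ l ih => exact (agreeUpTo_app (.cons (agreeUpTo_abs ih) .nil)).mono

theorem often_tSpine_iff {P : Head (Con C) → Prop} {Ms : List (BohmTree (Con C))} :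
    Often P (tSpine Ms) ↔ ∀ M ∈ Ms, Often P M := by
  induction Ms with
  | nil => rw [often_iff]; simp [tSpine]
  | cons M Ms ih => rw [often_iff]; simp [tSpine, ih]

theorem often_sSpine_iff {P : Head (Con C) → Prop} {Ms : List (BohmTree (Con C))} :
    Often P (sSpine Ms) ↔ ∀ M ∈ Ms, Often P M := by
  induction Ms with
  | nil => rw [often_iff]; simp [sSpine]
  | cons M Ms ih => rw [often_iff]; simp [sSpine, ih, often_iff (M := app .progress [M])]

/-- An infinite trace leaves the finite block through one of the arguments, and a finite prefix does
not affect infinite occurrence. -/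
theorem often_encNode_iff {P : Head (Con C) → Prop} {l : ℕ} {h : Head C}
    {Ms : List (BohmTree (Con C))} : Often P (encNode l h Ms) ↔ ∀ M ∈ Ms, Often P M := by
  induction l with
  | zero =>
    rw [often_iff]
    cases h with
    | var i => simp [neutral, often_iff (M := app .varntm _), often_iff (M := node _ _ _),
        often_tSpine_iff]
    | con c => simp [neutral, often_iff (M := app .constntm _), often_iff (M := app (.const c) _),
        often_sSpine_iff]
  | succ l ih =>
    rw [often_iff, ← ih, often_iff (M := encNode l h Ms)]
    simp [often_iff (M := abs _)]

theorem IsEncoding.agreeUpTo_decode {enc : BohmTree C → BohmTree (Con C)} (he : IsEncoding enc)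
    (k : ℕ) : ∀ {n : ℕ} {N : BohmTree (Con C)}, Typed n (.fam .ctm) N → Often IsProgress N →
      AgreeUpTo k (enc (decode N)) N := by
  induction k with
  | zero => exact fun _ _ => trivial
  | succ k ih =>
    intro n N hN ho
    obtain ⟨l, h, Ms, rfl⟩ := exists_eq_encNode ho.reaches (.inl rfl) hN
    rw [typed_encNode_iff] at hN
    rw [often_encNode_iff] at ho
    rw [decode_encNode, he.eq_encNode, lams_node, head_node, args_node, List.map_map]
    refine agreeUpTo_encNode l h ?_
    rw [List.forall₂_map_left_iff, List.forall₂_same]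
    exact fun M hM => ih (hN.2 M hM) (ho M hM)

theorem IsEncoding.encode_decode {enc : BohmTree C → BohmTree (Con C)} (he : IsEncoding enc)
    {n : ℕ} {N : BohmTree (Con C)} (hN : Typed n (.fam .ctm) N) (ho : Often IsProgress N) :
    enc (decode N) = N :=
  eq_of_agreeUpTo fun k => he.agreeUpTo_decode k hN ho

/-! ### Productivity and validity -/

/-- The head is a constant. -/
def IsCon (h : Head C) : Prop := ∃ c, h = .con c

theorem transGen_tSpine {M : BohmTree (Con C)} {Ms : List (BohmTree (Con C))} (hM : M ∈ Ms) :
    Relation.TransGen (ArgAvoiding IsProgress) M (tSpine Ms) := by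
  induction Ms with
  | nil => cases hM
  | cons M' Ms ih =>
    obtain rfl | hM := List.mem_cons.1 hM
    · exact .single ⟨by simp [tSpine], by simp [tSpine, IsProgress]⟩
    · exact .tail (ih hM) ⟨by simp [tSpine], by simp [tSpine, IsProgress]⟩

/-- The path from a variable-headed node to an argument uses only `lam`, `base`, `varntm` and
`tcons`. -/
theorem transGen_encNode_var {M : BohmTree (Con C)} {Ms : List (BohmTree (Con C))} (hM : M ∈ Ms)
    (l i : ℕ) :
    Relation.TransGen (ArgAvoiding IsProgress) M (encNode l (.var i) Ms) := by
  induction l with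
  | zero =>
    refine .tail (.tail (transGen_tSpine hM) (c := neutral (.var i) Ms) ?_) ?_ <;>
      exact ⟨by simp [neutral], by simp [neutral, IsProgress]⟩
  | succ l ih =>
    refine .tail (b := abs (encNode l (.var i) Ms)) ?_ ⟨by simp, by simp [IsProgress]⟩
    -- The last step of the path sees only head and arguments, so it can end in the `abs` instead.
    obtain ⟨L, hL, hLN⟩ := Relation.TransGen.tail'_iff.1 ih
    exact .tail' hL (by simpa [ArgAvoiding] using hLN)

/-- One step from `M` to an argument is several steps in `enc M`, so the induction runs over the
transitive closure. -/
theorem IsEncoding.reaches_isCon {enc : BohmTree C → BohmTree (Con C)} (he : IsEncoding enc)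
    {M : BohmTree C} (h : Reaches IsProgress (enc M)) : Reaches IsCon M := by
  generalize hN : enc M = N at h
  replace h := h.transGen
  induction h generalizing M with
  | intro N _ ih =>
    subst hN
    rw [reaches_iff]
    cases hh : M.head with
    | con c => exact .inl ⟨c, rfl⟩
    | var i =>
      refine .inr fun L hL => ih (enc L) ?_ rfl
      rw [he.eq_encNode M, hh]
      exact transGen_encNode_var (List.mem_map_of_mem hL) _ _

theorem IsEncoding.productive {enc : BohmTree C → BohmTree (Con C)} (he : IsEncoding enc)
    {M : BohmTree C} (h : Often IsProgress (enc M)) : M.Productive := by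
  refine often_of_forall_reaches (P := IsCon) fun k => ?_
  induction k generalizing M with
  | zero => trivial
  | succ k ih =>
    refine ⟨he.reaches_isCon h.reaches, fun L hL => ih ?_⟩
    rw [he.eq_encNode, often_encNode_iff] at h
    exact h _ (List.mem_map_of_mem hL)

/-- The property of all subtrees of valid encodings: each infinite trace meets the coinductive
constructor, and the constants of the encoded language have no arguments. -/
def Guarded (N : BohmTree (Con C)) : Prop :=
  Reaches IsProgress N ∧ ∀ c, N.head = .con (.const c) → N.args = []

theorem reaches_tSpine {Ms : List (BohmTree (Con C))} (h : ∀ M ∈ Ms, Reaches IsProgress M) :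
    Reaches IsProgress (tSpine Ms) := by
  induction Ms with
  | nil => rw [reaches_iff]; simp [tSpine]
  | cons M Ms ih =>
    rw [reaches_iff]
    simp only [List.mem_cons, forall_eq_or_imp] at h
    simp [tSpine, h.1, ih h.2]

theorem reaches_progress (M : BohmTree (Con C)) : Reaches IsProgress (app .progress [M]) :=
  reaches_iff.2 (.inl rfl)

theorem reaches_sSpine (Ms : List (BohmTree (Con C))) : Reaches IsProgress (sSpine Ms) := by
  induction Ms with
  | nil => rw [reaches_iff]; simp [sSpine]
  | cons M Ms ih => rw [reaches_iff]; simp [sSpine, reaches_progress, ih]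

theorem reaches_of_args_eq_nil {P : Head (Con C) → Prop} {N : BohmTree (Con C)}
    (h : N.args = []) : Reaches P N := by
  rw [reaches_iff]; simp [h]

/-- Arguments of a constant sit behind `progress`; only those of a variable have to reach it
themselves. -/
theorem reaches_neutral {h : Head C} {Ms : List (BohmTree (Con C))}
    (hM : ∀ i, h = .var i → ∀ M ∈ Ms, Reaches IsProgress M) :
    Reaches IsProgress (neutral h Ms) := by
  rw [reaches_iff]
  cases h with
  | var i => simp [neutral, reaches_tSpine (hM i rfl), reaches_of_args_eq_nil]
  | con c => simp [neutral, reaches_sSpine, reaches_of_args_eq_nil]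

theorem reaches_encNode {l : ℕ} {h : Head C} {Ms : List (BohmTree (Con C))}
    (hM : ∀ i, h = .var i → ∀ M ∈ Ms, Reaches IsProgress M) :
    Reaches IsProgress (encNode l h Ms) := by
  induction l with
  | zero => rw [reaches_iff]; simp [reaches_neutral hM]
  | succ l ih =>
    rw [reaches_iff] at ih ⊢
    simpa [reaches_iff (M := abs _)] using .inr ih

theorem IsEncoding.reaches_isProgress {enc : BohmTree C → BohmTree (Con C)} (he : IsEncoding enc)
    {M : BohmTree C} (h : Reaches IsCon M) : Reaches IsProgress (enc M) := by
  induction h with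
  | intro M _ ih =>
    rw [he.eq_encNode]
    refine reaches_encNode fun i hi N hN => ?_
    obtain ⟨L, hL, rfl⟩ := List.mem_map.1 hN
    exact ih L ⟨hL, by simp [IsCon, hi]⟩

theorem allUpTo_of_args_eq_nil {Q : BohmTree (Con C) → Prop} {N : BohmTree (Con C)} (k : ℕ)
    (hQ : Q N) (h : N.args = []) : AllUpTo Q k N := by
  cases k with
  | zero => trivial
  | succ k => exact ⟨hQ, by simp [h]⟩

/-- Reachability of the entries is a separate hypothesis because `AllUpTo Guarded 0` carries no
information. -/
theorem allUpTo_tSpine {k : ℕ} {Ms : List (BohmTree (Con C))}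
    (hr : ∀ M ∈ Ms, Reaches IsProgress M) (h : ∀ M ∈ Ms, AllUpTo Guarded k M) :
    AllUpTo Guarded (k + 1) (tSpine Ms) := by
  induction Ms with
  | nil => exact allUpTo_of_args_eq_nil _ ⟨reaches_tSpine hr, by simp [tSpine]⟩ (by simp [tSpine])
  | cons M Ms ih =>
    refine ⟨⟨reaches_tSpine hr, by simp [tSpine]⟩, ?_⟩
    simp only [List.mem_cons, forall_eq_or_imp] at hr h
    simpa [tSpine] using ⟨h.1, (ih hr.2 h.2).mono⟩

theorem allUpTo_sSpine {k : ℕ} {Ms : List (BohmTree (Con C))}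
    (h : ∀ M ∈ Ms, AllUpTo Guarded k M) : AllUpTo Guarded (k + 1) (sSpine Ms) := by
  induction Ms with
  | nil =>
    exact allUpTo_of_args_eq_nil _ ⟨reaches_sSpine _, by simp [sSpine]⟩ (by simp [sSpine])
  | cons M Ms ih =>
    refine ⟨⟨reaches_sSpine _, by simp [sSpine]⟩, ?_⟩
    simp only [List.mem_cons, forall_eq_or_imp] at h
    have hp : AllUpTo Guarded (k + 1) (app .progress [M]) :=
      ⟨⟨reaches_progress _, by simp⟩, by simpa using h.1⟩
    simpa [sSpine] using ⟨hp.mono, (ih h.2).mono⟩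

theorem allUpTo_neutral {k : ℕ} {h : Head C} {Ms : List (BohmTree (Con C))}
    (hr : ∀ i, h = .var i → ∀ M ∈ Ms, Reaches IsProgress M)
    (hM : ∀ M ∈ Ms, AllUpTo Guarded k M) : AllUpTo Guarded (k + 1) (neutral h Ms) := by
  refine ⟨⟨reaches_neutral hr, by cases h <;> simp [neutral]⟩, ?_⟩
  cases h with
  | var i =>
    simpa [neutral] using ⟨allUpTo_of_args_eq_nil _ ⟨reaches_of_args_eq_nil (by simp), by simp⟩
      (by simp), (allUpTo_tSpine (hr i rfl) hM).mono⟩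
  | con c =>
    simpa [neutral] using ⟨allUpTo_of_args_eq_nil _ ⟨reaches_of_args_eq_nil (by simp), by simp⟩
      (by simp), (allUpTo_sSpine hM).mono⟩

theorem allUpTo_encNode {k l : ℕ} {h : Head C} {Ms : List (BohmTree (Con C))}
    (hr : ∀ i, h = .var i → ∀ M ∈ Ms, Reaches IsProgress M)
    (hM : ∀ M ∈ Ms, AllUpTo Guarded k M) : AllUpTo Guarded (k + 1) (encNode l h Ms) := by
  induction l with
  | zero =>
    exact ⟨⟨reaches_encNode hr, by simp⟩, by simpa using (allUpTo_neutral hr hM).mono⟩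
  | succ l ih =>
    refine ⟨⟨reaches_encNode hr, by simp⟩, ?_⟩
    have ha : AllUpTo Guarded (k + 1) (abs (encNode l h Ms)) := by
      refine ⟨⟨?_, by simpa using ih.1.2⟩, by simpa using ih.2⟩
      simpa only [reaches_iff (M := abs _), head_abs, args_abs, ← reaches_iff] using ih.1.1
    simpa using ha.mono

theorem IsEncoding.allUpTo_guarded {enc : BohmTree C → BohmTree (Con C)} (he : IsEncoding enc)
    (k : ℕ) : ∀ {M : BohmTree C}, M.Productive → AllUpTo Guarded k (enc M) := by
  induction k with
  | zero => exact fun _ => trivial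
  | succ k ih =>
    intro M hM
    have hL : ∀ L ∈ M.args, L.Productive := fun L hL =>
      Often.of_mem_args (P := IsCon) hM hL
    rw [he.eq_encNode]
    refine allUpTo_encNode (fun _ _ => ?_) ?_ <;>
      simp only [List.mem_map, forall_exists_index, and_imp, forall_apply_eq_imp_iff₂]
    · exact fun L h => he.reaches_isProgress (Often.reaches (P := IsCon) (hL L h))
    · exact fun L h => ih (hL L h)

theorem coinductive_iff {c : Con C} : (sig C).Coinductive c ↔ c = .progress := by
  cases c <;> simp [Signature.Coinductive, Signature.Constructs, sig, ArrowTy.toOmega, conTy,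
    ArrowTy.expand, Ty.target, famKind, Knd.IsCotype]

theorem IsEncoding.traceValid {enc : BohmTree C → BohmTree (Con C)} (he : IsEncoding enc)
    {M : BohmTree C} (hM : M.Productive) : (sig C).TraceValid (enc M) := by
  intro T hT
  refine ⟨.progress, coinductive_iff.2 rfl, ?_, fun c' hc' => ?_⟩
  · exact often_of_forall_reaches (fun k => (he.allUpTo_guarded k hM).imp fun _ h => h.1) T hT
  -- `const c` would outrank `progress`, but it has no arguments, so no infinite trace continues
  -- from it.
  · have hc : ∀ c, c' ≠ .const c := by
      rintro c rfl
      obtain ⟨b, hb₀, hb, hTb⟩ := hT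
      obtain ⟨i, -, hi⟩ := hc' 0
      have hg := allUpTo_branch hb (fun k => hb₀ ▸ he.allUpTo_guarded k hM) i
      have := hb i
      rw [hg.2 c (hTb i ▸ hi)] at this
      cases this
    cases c'
    case const c => exact absurd rfl (hc c)
    -- All other constructors build families declared no later than `pCtm`.
    all_goals exact ⟨_, _, rfl, rfl, by simp [sig, famRank]⟩

theorem often_isProgress_of_traceValid {N : BohmTree (Con C)} (h : (sig C).TraceValid N) :
    Often IsProgress N := by
  intro T hT
  obtain ⟨c, hc, ho, -⟩ := h T hT
  rw [coinductive_iff] at hc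
  subst hc
  exact ho

theorem isCanonicalTerm_iff {n : ℕ} {N : BohmTree (Con C)} :
    (sig C).IsCanonicalTerm (varsCtx C n) N (ctmTy C) ↔
      Typed n (.fam .ctm) N ∧ (sig C).TraceValid N := by
  have hΓ : ∀ k, (varsCtx C n).map (fun B => B.obs k) = varsCtxAt C n k := fun k =>
    List.map_replicate
  simp only [Signature.IsCanonicalTerm, hΓ]
  rfl

end Internal

-- The adequacy theorem

theorem mainTheorem7 (C : Type u) :
    ∃ enc : BohmTree C → BohmTree (Internal.Con C),
      Internal.IsEncoding enc ∧
      ∀ n : ℕ, Set.BijOn enc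
        {M | M.ScopedIn n ∧ M.Productive}
        {N | (Internal.sig C).IsCanonicalTerm (Internal.varsCtx C n) N (Internal.ctmTy C)} := by
  have he := Internal.isEncoding_encode (C := C)
  refine ⟨Internal.encode, he, fun n => ⟨?_, he.injective.injOn, ?_⟩⟩
  · rintro M ⟨hs, hp⟩
    exact Internal.isCanonicalTerm_iff.2 ⟨fun k => he.typedAt k hs, he.traceValid hp⟩
  · intro N hN
    obtain ⟨ht, hv⟩ := Internal.isCanonicalTerm_iff.1 hN
    have ho := Internal.often_isProgress_of_traceValid hv
    have hd := he.encode_decode ht ho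
    -- With `N` rewritten as the encoding of `decode N`, its typing yields the scoping and its
    -- validity the productivity of `decode N`.
    exact ⟨Internal.decode N, ⟨he.scopedIn (hd.symm ▸ ht), he.productive (hd.symm ▸ ho)⟩, hd⟩
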